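/- **Corollary (IFO complexity of R-AbaSVRG).** There are absolute constants $\varrho_1>0$ and $C>0$ such that the following holds. *Setting.* Let $\mathcal M$ be a finite-dimensional smooth Riemannian manifold with Riemannian distance $d$, let $f=\mathbb E_i[f_i]$ where the index $i$ is uniform on $[n]=\{1,\dots,n\}$, $n\ge 1$ (finite-sum), or has an arbitrary probability law, the samples being independent with that law (online; there the oracle $i\mapsto \mathrm{grad} f_i(x)$ is measurable and unbiased, $\mathbb E_i\,\mathrm{grad} f_i(x)=\mathrm{grad} f(x)$ for $x\in\mathcal X$, and the iterates and the vectors $v^s_t$ are random variables). Let $R$ be a retraction, $\mathcal T_x^y:T_x\mathcal M\to T_y\mathcal M$ an isometric vector transport, and $\mathcal X$ a (Borel, in the online setting) neighbourhood of a point $x^*$ with $f(x^*)=\min_{\mathcal X}f$, such that for some $r\in(0,\infty]$ and all $x\in\mathcal X$, $R_x$ is a diffeomorphism of the ball of radius $r$ in $T_x\mathcal M$ onto an open set containing $\mathcal X$; let $R_x^{-1}$ be its inverse. Likewise $\mathcal X$ is totally normal (the same holds for the exponential map, with some radius). Assume $f,f_i\in C^2$ and that there are positive constants $G,H,\sigma,L,L_l,\theta,\mu,\nu$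 such that for all $x,y\in\mathcal X$, with $\xi=R_x^{-1}(y)$, and all $i$: 1. $\|\mathrm{grad} f_i(x)\|\le G$, $\|\mathrm{Hess} f_i(x)\|\le H$, $\ \mathbb E_i\|\mathrm{grad} f_i(x)-\mathrm{grad} f(x)\|^2\le\sigma^2$; 2. $f(y)\le f(x)+\langle \mathrm{grad} f(x),\xi\rangle+\frac L2\|\xi\|^2$; 3. $\mathbb E_i\|\mathrm{grad} f_i(x)-P_y^x\,\mathrm{grad} f_i(y)\|^2\le L_l^2\|\xi\|^2$, and $\|\mathcal T_x^y u-P_x^y u\|\le\theta\|\xi\|\|u\|$ for $u\in T_x\mathcal M$, where $P_x^y$ is parallel transport along $t\mapsto R_x(t\xi)$ and $P_y^x$ its inverse; 4. $\|\xi\|\le\mu\, d(x,y)$ and $d(x,y)\le\nu\|\xi\|$. *Algorithm.* Let $\epsilon>0$, $\eta=\frac{3}{2L+2\sqrt{L^2+3(L_l+\theta G)^2\mu^2\nu^2}}$, $m=\lfloor n^{1/3}\rfloor$ (finite-sum) or $m=\lceil(\sigma/\epsilon)^{2/3}\rceil$ (online), $b=m^2$, $\alpha_1,\alpha_2\ge\alpha=4$,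 $\Delta=f(\tilde x^0)-f(x^*)$, $S=\max\{1,\lceil 4\Delta/(\epsilon^2 m\eta)\rceil\}$ and $0<\beta_1\le\epsilon^2S$. For $s=1,\dots,S$: set $x_0^s=\tilde x^{s-1}$, let $B^s$ be $\min\{\alpha_1\sigma^2/\beta_s,n\}$ (finite-sum) or $\min\{\alpha_1\sigma^2/\beta_s,\alpha_2\sigma^2/\epsilon^2\}$ (online), rounded up (with $\alpha_1\sigma^2/0=\infty$); draw a batch of $B^s$ indices (without replacement from $[n]$ in the finite-sum setting, independently from the law of $i$ online) and let $v_0^s$ be the average of the component gradients at $x^s_0$ over it (this is the $v_0^s$ on the right-hand side below). For $t=0,\dots,m-1$ draw $b$ indices $\mathcal I^s_t$ independently from the law of $i$ and set $$v_t^s=\mathrm{grad} f_{\mathcal I_t^s}(x_t^s)-\mathcal T_{x_0^s}^{x_t^s}\big(\mathrm{grad} f_{\mathcal I_t^s}(x_0^s)-v_0^s\big),\qquad x_{t+1}^s=R_{x_t^s}(-\eta v_t^s).$$ Set $\beta_{s+1}=\frac1m\sum_{t<m}\|v_t^s\|^2$ and $\tilde x^s=x_m^s$. The output $\tilde x$ is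 uniform on $\{x_t^s: 1\le s\le S,\ 0\le t<m\}$. Assume that (almost surely) the iterates stay continuously in $\mathcal X$: $R_{x_t^s}(-\tau\eta v_t^s)\in\mathcal X$ for all $s,t$ and $\tau\in[0,1]$. *Conclusion.* Let $\tilde B=\frac1S\sum_{s=1}^S B^s$ and $\Theta_1=L+\sqrt{L^2+\varrho_1(L_l+\theta G)^2\mu^2\nu^2}$. Then $\mathbb E\|\mathrm{grad} f(\tilde x)\|\le\epsilon$, and for every realization the number of IFO calls (evaluations of some $\mathrm{grad} f_i(x)$) is, provided $\epsilon^2m\eta\le4\Delta$, at most $$C\Big(\tilde B+\frac{\Delta\Theta_1\tilde B}{n^{1/3}\epsilon^2}+\frac{\Delta\Theta_1n^{2/3}}{\epsilon^2}\Big)\ \text{(finite-sum)},\qquad C\Big(\frac{\Delta\Theta_1\tilde B}{\sigma^{2/3}\epsilon^{4/3}}+\frac{\Delta\Theta_1\sigma^{4/3}}{\epsilon^{10/3}}\Big)\ \text{(online)}.$$ Without the proviso $\epsilon^2m\eta\le 4\Delta$ the bounds hold with $n$ (finite-sum), respectively $\tilde B+\sigma^2/\epsilon^2$ (online), added inside the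 parentheses. -/

import Mathlib

open Set MeasureTheory Manifold Bundle
open scoped ENNReal ContDiff Topology BigOperators

noncomputable section

namespace RAbaSVRG

section Geometry

variable {E : Type*} [NormedAddCommGroup E] [NormedSpace ℝ E] [FiniteDimensional ℝ E]
  {M : Type*} [EMetricSpace M] [ChartedSpace E M]
  [RiemannianBundle (fun x : M => TangentSpace 𝓘(ℝ, E) x)]

instance completeSpace_tangentSpace (x : M) : CompleteSpace (TangentSpace 𝓘(ℝ, E) x) :=
  haveI : FiniteDimensional ℝ (TangentSpace 𝓘(ℝ, E) x) := ‹FiniteDimensional ℝ E›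
  FiniteDimensional.complete ℝ _

/-- The Riemannian gradient: the Riesz representative of the differential. -/
def grad (g : M → ℝ) (x : M) : TangentSpace 𝓘(ℝ, E) x :=
  (InnerProductSpace.toDual ℝ (TangentSpace 𝓘(ℝ, E) x)).symm (mfderiv 𝓘(ℝ, E) 𝓘(ℝ, ℝ) g x)

/-- Coordinates of a tangent vector `v ∈ T_p M` in the chart at `x₀`. -/
def chartCoord (x₀ p : M) (v : TangentSpace 𝓘(ℝ, E) p) : E :=
  mfderiv 𝓘(ℝ, E) 𝓘(ℝ, E) (chartAt E x₀) p v

/-- The metric in the chart at `x₀`: `g_z(u, v) = ⟨∂_u, ∂_v⟩`. -/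
def chartMetric (x₀ : M) (z u v : E) : ℝ :=
  inner ℝ (mfderiv 𝓘(ℝ, E) 𝓘(ℝ, E) (chartAt E x₀).symm z u)
    (mfderiv 𝓘(ℝ, E) 𝓘(ℝ, E) (chartAt E x₀).symm z v)

/-- Christoffel symbols of the first kind of the Levi-Civita connection in the chart at `x₀`:
`⟨∇_{∂_u} ∂_v, ∂_w⟩ = ½ (∂_u g(v, w) + ∂_v g(u, w) - ∂_w g(u, v))`. -/
def christoffel (x₀ : M) (z u v w : E) : ℝ :=
  (fderiv ℝ (fun y => chartMetric x₀ y v w) z u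
    + fderiv ℝ (fun y => chartMetric x₀ y u w) z v
    - fderiv ℝ (fun y => chartMetric x₀ y u v) z w) / 2

/-- A vector field `W` along the curve `t ↦ (W t).proj`, `t ∈ [0, 1]`, is parallel for the
Levi-Civita connection: `⟨V' + Γ(c', V), w⟩ = 0` for all `w`, where at each time `c` and `V` are
the coordinates of the curve and of the field in the chart at the current point. -/
def IsParallelField (W : ℝ → TangentBundle 𝓘(ℝ, E) M) : Prop :=
  ∀ t₀ ∈ Icc (0 : ℝ) 1, ∃ c' V' : E,
    ContinuousWithinAt (fun t => (W t).proj) (Icc 0 1) t₀ ∧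
    HasDerivWithinAt (fun t => chartAt E (W t₀).proj (W t).proj) c' (Icc 0 1) t₀ ∧
    HasDerivWithinAt (fun t => chartCoord (W t₀).proj (W t).proj (W t).2) V' (Icc 0 1) t₀ ∧
    ∀ w : E,
      chartMetric (W t₀).proj (chartAt E (W t₀).proj (W t₀).proj) V' w
        + christoffel (W t₀).proj (chartAt E (W t₀).proj (W t₀).proj) c'
            (chartCoord (W t₀).proj (W t₀).proj (W t₀).2) w = 0

/-- `P : T_x M → T_y M` is the parallel transport along the curve `c` on `[0, 1]` from `x = c 0`
to `y = c 1`. -/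
def IsParallelTransport (c : ℝ → M) {x y : M}
    (P : TangentSpace 𝓘(ℝ, E) x ≃ₗᵢ[ℝ] TangentSpace 𝓘(ℝ, E) y) : Prop :=
  ∀ u : TangentSpace 𝓘(ℝ, E) x, ∃ W : ℝ → TangentBundle 𝓘(ℝ, E) M,
    IsParallelField W ∧ (∀ t ∈ Icc (0 : ℝ) 1, (W t).proj = c t) ∧
    W 0 = ⟨x, u⟩ ∧ W 1 = ⟨y, P u⟩

/-- The velocity field of a curve on `[0, 1]`. -/
def velocity (γ : ℝ → M) (t : ℝ) : TangentBundle 𝓘(ℝ, E) M :=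
  ⟨γ t, mfderivWithin 𝓘(ℝ, ℝ) 𝓘(ℝ, E) γ (Icc 0 1) t (1 : ℝ)⟩

/-- Smooth curves on `[0, 1]` with parallel velocity. -/
def IsGeodesic (γ : ℝ → M) : Prop :=
  ContMDiffOn 𝓘(ℝ, ℝ) 𝓘(ℝ, E) ∞ γ (Icc 0 1) ∧ IsParallelField (E := E) (velocity γ)

/-- The Riemannian Hessian `Hess g (u, v) = D²g(u, v) - Dg(Γ(u, v))` at `x`, in the chart at `x`. -/
def hess (g : M → ℝ) (x : M) (u v : TangentSpace 𝓘(ℝ, E) x) : ℝ :=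
  fderiv ℝ (fun z => fderiv ℝ (g ∘ (chartAt E x).symm) z (chartCoord x x v)) (chartAt E x x)
      (chartCoord x x u)
    - christoffel x (chartAt E x x) (chartCoord x x u) (chartCoord x x v)
        (chartCoord x x (grad g x))

/-- A retraction: smooth on the tangent bundle, `R_x(0) = x` and `D R_x(0) = id`. -/
structure IsRetraction (R : ∀ x : M, TangentSpace 𝓘(ℝ, E) x → M)
    [IsManifold 𝓘(ℝ, E) ∞ M] : Prop where
  smooth : ContMDiff 𝓘(ℝ, E).tangent 𝓘(ℝ, E) ∞ (fun p : TangentBundle 𝓘(ℝ, E) M => R p.1 p.2)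
  map_zero : ∀ x, R x 0 = x
  deriv_zero : ∀ (x : M) (ξ : TangentSpace 𝓘(ℝ, E) x),
    (⟨R x ((0 : ℝ) • ξ), mfderiv 𝓘(ℝ, ℝ) 𝓘(ℝ, E) (fun t : ℝ => R x (t • ξ)) 0 (1 : ℝ)⟩ :
      TangentBundle 𝓘(ℝ, E) M) = ⟨x, ξ⟩

/-- `h` restricts to a diffeomorphism from the open ball of radius `r` about `0 ∈ T_x M` onto an
open set containing `X`. -/
def IsDiffeoOnBall (X : Set M) (r : ℝ≥0∞) (x : M) (h : TangentSpace 𝓘(ℝ, E) x → M) : Prop :=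
  ∃ e : OpenPartialHomeomorph (TangentSpace 𝓘(ℝ, E) x) M,
    e.source = {ξ | ‖ξ‖ₑ < r} ∧ EqOn e h e.source ∧ X ⊆ e.target ∧
    ContMDiffOn 𝓘(ℝ, TangentSpace 𝓘(ℝ, E) x) 𝓘(ℝ, E) ∞ e e.source ∧
    ContMDiffOn 𝓘(ℝ, E) 𝓘(ℝ, TangentSpace 𝓘(ℝ, E) x) ∞ e.symm e.target

/-- Totally retractive set, with radius `r ∈ (0, ∞]`. -/
def IsTotallyRetractive (R : ∀ x : M, TangentSpace 𝓘(ℝ, E) x → M) (X : Set M) (r : ℝ≥0∞) : Prop :=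
  0 < r ∧ ∀ x ∈ X, IsDiffeoOnBall X r x (R x)

/-- Totally normal set: the same with the exponential map, `h u` being the time-one point of the
geodesic with initial velocity `u`. -/
def IsTotallyNormal (E : Type*) [NormedAddCommGroup E] [NormedSpace ℝ E] [FiniteDimensional ℝ E]
    {M : Type*} [EMetricSpace M] [ChartedSpace E M]
    [RiemannianBundle (fun x : M => TangentSpace 𝓘(ℝ, E) x)] (X : Set M) : Prop :=
  ∃ r : ℝ≥0∞, 0 < r ∧ ∀ x ∈ X, ∃ h : TangentSpace 𝓘(ℝ, E) x → M,
    (∀ u, ‖u‖ₑ < r → IsGeodesic (E := E) (fun t : ℝ => h (t • u)) ∧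
      velocity (E := E) (fun t : ℝ => h (t • u)) 0 = ⟨x, u⟩) ∧
    IsDiffeoOnBall X r x h

end Geometry

/-- The data of the stochastic optimization problem and of the algorithm: components `F i`,
retraction `R`, vector transport `T x y : T_x M → T_y M` (a linear isometry), neighbourhood `X`
with radius `r`, optimal point, initial point, and the constants of the assumptions. -/
structure Problem (E M ι : Type*) [NormedAddCommGroup E] [NormedSpace ℝ E]
    [EMetricSpace M] [ChartedSpace E M] [RiemannianBundle (fun x : M => TangentSpace 𝓘(ℝ, E) x)] where
  F : ι → M → ℝ
  R : ∀ x : M, TangentSpace 𝓘(ℝ, E) x → M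
  T : ∀ x y : M, TangentSpace 𝓘(ℝ, E) x →ₗᵢ[ℝ] TangentSpace 𝓘(ℝ, E) y
  X : Set M
  r : ℝ≥0∞
  xopt : M
  xinit : M
  G : ℝ
  H : ℝ
  σ : ℝ
  L : ℝ
  Ll : ℝ
  θ : ℝ
  μ : ℝ
  ν : ℝ

namespace Problem

variable {E : Type*} [NormedAddCommGroup E] [NormedSpace ℝ E] [FiniteDimensional ℝ E]
  {M : Type*} [EMetricSpace M] [ChartedSpace E M]
  [RiemannianBundle (fun x : M => TangentSpace 𝓘(ℝ, E) x)]
  {ι : Type*} [MeasurableSpace ι] (D : Problem E M ι) (P : Measure ι)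

/-- The objective `f(x) = 𝔼_i [F i x]`, `i ∼ P`. -/
def obj (x : M) : ℝ := ∫ i, D.F i x ∂P

/-- `Δ = f(x̃⁰) - f(x*)`. -/
def Δ : ℝ := D.obj P D.xinit - D.obj P D.xopt

/-- The assumptions on the problem; `P` is the law of the component index. A vector `ξ ∈ T_x M`
with `‖ξ‖ < r` and `R_x(ξ) = y` is the vector `R_x⁻¹(y)`. -/
structure Assumptions [IsManifold 𝓘(ℝ, E) ∞ M] : Prop where
  pos : 0 < D.G ∧ 0 < D.H ∧ 0 < D.σ ∧ 0 < D.L ∧ 0 < D.Ll ∧ 0 < D.θ ∧ 0 < D.μ ∧ 0 < D.ν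
  retraction : IsRetraction D.R
  transport_self : ∀ (x : M) (v : TangentSpace 𝓘(ℝ, E) x), D.T x x v = v
  smooth_component : ∀ i, ContMDiff 𝓘(ℝ, E) 𝓘(ℝ, ℝ) 2 (D.F i)
  smooth_obj : ContMDiff 𝓘(ℝ, E) 𝓘(ℝ, ℝ) 2 (D.obj P)
  nhds_opt : D.X ∈ 𝓝 D.xopt
  opt : ∀ x ∈ D.X, D.obj P D.xopt ≤ D.obj P x
  totallyRetractive : IsTotallyRetractive D.R D.X D.r
  grad_bound : ∀ x ∈ D.X, ∀ i, ‖grad (E := E) (D.F i) x‖ ≤ D.G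
  hess_bound : ∀ x ∈ D.X, ∀ i, ∀ u v : TangentSpace 𝓘(ℝ, E) x,
    |hess (D.F i) x u v| ≤ D.H * ‖u‖ * ‖v‖
  variance_bound : ∀ x ∈ D.X,
    ∫ i, ‖grad (E := E) (D.F i) x - grad (E := E) (D.obj P) x‖ ^ 2 ∂P ≤ D.σ ^ 2
  retraction_smooth : ∀ x ∈ D.X, ∀ ξ : TangentSpace 𝓘(ℝ, E) x, ‖ξ‖ₑ < D.r → D.R x ξ ∈ D.X →
    D.obj P (D.R x ξ) ≤ D.obj P x + inner ℝ (grad (D.obj P) x) ξ + D.L / 2 * ‖ξ‖ ^ 2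
  average_lipschitz : ∀ x ∈ D.X, ∀ ξ : TangentSpace 𝓘(ℝ, E) x, ‖ξ‖ₑ < D.r → D.R x ξ ∈ D.X →
    ∃ Q : TangentSpace 𝓘(ℝ, E) x ≃ₗᵢ[ℝ] TangentSpace 𝓘(ℝ, E) (D.R x ξ),
      IsParallelTransport (fun t : ℝ => D.R x (t • ξ)) Q ∧
      ∫ i, ‖grad (D.F i) x - Q.symm (grad (D.F i) (D.R x ξ))‖ ^ 2 ∂P ≤ (D.Ll * ‖ξ‖) ^ 2
  transport_close : ∀ x ∈ D.X, ∀ ξ : TangentSpace 𝓘(ℝ, E) x, ‖ξ‖ₑ < D.r → D.R x ξ ∈ D.X →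
    ∀ Q : TangentSpace 𝓘(ℝ, E) x ≃ₗᵢ[ℝ] TangentSpace 𝓘(ℝ, E) (D.R x ξ),
      IsParallelTransport (fun t : ℝ => D.R x (t • ξ)) Q →
      ∀ u : TangentSpace 𝓘(ℝ, E) x,
        ‖D.T x (D.R x ξ) u - Q u‖ ≤ D.θ * ‖ξ‖ * ‖u‖
  totallyNormal : IsTotallyNormal E D.X
  dist_compare : ∀ x ∈ D.X, ∀ ξ : TangentSpace 𝓘(ℝ, E) x, ‖ξ‖ₑ < D.r → D.R x ξ ∈ D.X →
    ‖ξ‖ₑ ≤ ENNReal.ofReal D.μ * edist x (D.R x ξ) ∧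
    edist x (D.R x ξ) ≤ ENNReal.ofReal D.ν * ‖ξ‖ₑ

/-- Measurability in the sample and unbiasedness of the first-order oracle. -/
structure Oracle : Prop where
  measurableSet : MeasurableSet[borel M] D.X
  integrable : ∀ x, Integrable (fun i => D.F i x) P
  measurable_grad : ∀ x ∈ D.X, AEStronglyMeasurable (fun i => grad (E := E) (D.F i) x) P
  unbiased : ∀ x ∈ D.X, ∫ i, grad (E := E) (D.F i) x ∂P = grad (E := E) (D.obj P) x

/-- `L + √(L² + ϱ (L_l + θ G)² μ² ν²)`. -/
def Θ (ϱ : ℝ) : ℝ :=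
  D.L + √(D.L ^ 2 + ϱ * (D.Ll + D.θ * D.G) ^ 2 * D.μ ^ 2 * D.ν ^ 2)

/-- The step size. -/
def η : ℝ := 3 / (2 * D.L + 2 * √(D.L ^ 2 + 3 * (D.Ll + D.θ * D.G) ^ 2 * D.μ ^ 2 * D.ν ^ 2))

/-! ### The algorithm -/

end Problem

/-- Names of the random draws with mini-batch size `b`, epochs counted from `0`: `batch s j` is the
`j`-th index of the batch of epoch `s`, and `inner s t k` is the `k`-th index of the mini-batch at
step `t` of epoch `s`. -/
inductive Draw (b : ℕ) where
  | batch (s j : ℕ)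
  | inner (s t : ℕ) (k : Fin b)

/-- State of the algorithm: the iterate, the accumulator of `β`, and the number of component
gradients requested so far. -/
structure State (M : Type*) where
  x : M
  β : ℝ
  calls : ℕ

namespace Problem

variable {E : Type*} [NormedAddCommGroup E] [NormedSpace ℝ E] [FiniteDimensional ℝ E]
  {M : Type*} [EMetricSpace M] [ChartedSpace E M]
  [RiemannianBundle (fun x : M => TangentSpace 𝓘(ℝ, E) x)]
  {ι : Type*} (D : Problem E M ι)

/-- Mini-batch gradient `(1/k) ∑_j grad F_{I j}(x)`. -/
def batchGrad {k : ℕ} (I : Fin k → ι) (x : M) : TangentSpace 𝓘(ℝ, E) x :=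
  (k : ℝ)⁻¹ • ∑ j, grad (D.F (I j)) x

/-- `v_t = grad f_I(x_t) - T_{x₀}^{x_t} (grad f_I(x₀) - v₀)`. -/
def modGrad {b : ℕ} (x₀ : M) (v₀ : TangentSpace 𝓘(ℝ, E) x₀) (I : Fin b → ι) (x : M) :
    TangentSpace 𝓘(ℝ, E) x :=
  D.batchGrad I x - D.T x₀ x (D.batchGrad I x₀ - v₀)

/-- One inner step with step size `η`; it uses `2 b` oracle calls. -/
def innerStep (η : ℝ) (m : ℕ) {b : ℕ} (x₀ : M) (v₀ : TangentSpace 𝓘(ℝ, E) x₀) (I : Fin b → ι)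
    (st : State M) : State M where
  x := D.R st.x (-(η • D.modGrad x₀ v₀ I st.x))
  β := st.β + ‖D.modGrad x₀ v₀ I st.x‖ ^ 2 / m
  calls := st.calls + 2 * b

variable (η : ℝ) (m : ℕ) {b : ℕ} (batchSize : ℝ → ℕ) (β₁ : ℝ) (ζ : Draw b → ι)

/-- The batch gradient at the start of epoch `s`, from the state `st` at the end of the preceding
epoch: the batch consists of the first `batchSize st.β` batch draws. -/
def snapshotGrad (s : ℕ) (st : State M) : TangentSpace 𝓘(ℝ, E) st.x :=
  D.batchGrad (fun j : Fin (batchSize st.β) => ζ (.batch s j)) st.x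

/-- The state after `t` inner steps of epoch `s` started from `st`. -/
def innerState (s : ℕ) (st : State M) : ℕ → State M
  | 0 => ⟨st.x, 0, st.calls + batchSize st.β⟩
  | t + 1 => D.innerStep η m st.x (D.snapshotGrad batchSize ζ s st) (fun k => ζ (.inner s t k))
      (innerState s st t)

/-- The state before epoch `s`; its field `β` is the quantity that determines the batch size. -/
def epochState : ℕ → State M
  | 0 => ⟨D.xinit, β₁, 0⟩
  | s + 1 => D.innerState η m batchSize ζ s (epochState s) m

/-- The iterate `x_t^s`. -/
def iterate (s t : ℕ) : M :=
  (D.innerState η m batchSize ζ s (D.epochState η m batchSize β₁ ζ s) t).x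

/-- The modified gradient `v_t^s`. -/
def direction (s t : ℕ) : TangentSpace 𝓘(ℝ, E) (D.iterate η m batchSize β₁ ζ s t) :=
  D.modGrad (D.epochState η m batchSize β₁ ζ s).x
    (D.snapshotGrad batchSize ζ s (D.epochState η m batchSize β₁ ζ s))
    (fun k => ζ (.inner s t k)) (D.iterate η m batchSize β₁ ζ s t)

/-- The average batch size over `S` epochs. -/
def avgBatch (S : ℕ) : ℝ :=
  (∑ s ∈ Finset.range S, (batchSize (D.epochState η m batchSize β₁ ζ s).β : ℝ)) / S

/-- The number of oracle calls made in `S` epochs. -/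
def ifoCalls (S : ℕ) : ℕ := (D.epochState η m batchSize β₁ ζ S).calls

/-- The iterates of the first `S` epochs stay continuously in `X`: every update curve
`τ ↦ R_{x_t}(-τ η v_t)`, `τ ∈ [0, 1]`, lies in `X`. -/
def StaysIn (S : ℕ) : Prop :=
  ∀ s < S, ∀ t < m, ∀ τ ∈ Icc (0 : ℝ) 1,
    D.R (D.iterate η m batchSize β₁ ζ s t)
      (-((τ * η) • D.direction η m batchSize β₁ ζ s t)) ∈ D.X

/-- The expected gradient norm of the output given the draws `ζ`: the output is uniformly selected
among the `x_t^s`, `s < S`, `t < m`. -/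
def outputGradNorm [MeasurableSpace ι] (P : Measure ι) (S : ℕ) : ℝ :=
  (∑ s ∈ Finset.range S, ∑ t ∈ Finset.range m,
    ‖grad (E := E) (D.obj P) (D.iterate η m batchSize β₁ ζ s t)‖) / (S * m)

end Problem

/-- The number of epochs: `4 Δ / (ε² m η)`, rounded up to a positive integer. -/
def numEpochs (Δ ε η : ℝ) (m : ℕ) : ℕ := max 1 ⌈4 * Δ / (ε ^ 2 * m * η)⌉₊

/-- The batch size `min {α₁ σ² / β, n}`, rounded up, with `α₁ σ² / 0 = ∞`. -/
def finiteSumBatchSize (α₁ σ : ℝ) (n : ℕ) (β : ℝ) : ℕ :=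
  if β = 0 then n else ⌈min (α₁ * σ ^ 2 / β) n⌉₊

/-- The batch size `min {α₁ σ² / β, α₂ σ² / ε²}`, rounded up, with `α₁ σ² / 0 = ∞`. -/
def onlineBatchSize (α₁ α₂ σ ε β : ℝ) : ℕ :=
  if β = 0 then ⌈α₂ * σ ^ 2 / ε ^ 2⌉₊ else ⌈min (α₁ * σ ^ 2 / β) (α₂ * σ ^ 2 / ε ^ 2)⌉₊

/-- The uniform law on the component indices `{1, …, n}`. -/
def unif (n : ℕ) [NeZero n] : Measure (Fin n) := (PMF.uniformOfFintype (Fin n)).toMeasure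

/-- Outcomes of the sampling in the finite-sum setting, with the uniform law: for each epoch a
permutation of `[n]`, whose first `B` entries are a sample of size `B` without replacement, and
for each inner step `b` indices drawn with replacement. -/
abbrev FiniteSumSample (n S m b : ℕ) : Type :=
  (Fin S → Equiv.Perm (Fin n)) × (Fin S → Fin m → Fin b → Fin n)

/-- The draws given by an outcome (only `s < S`, `t < m`, `j < n` are used). -/
def FiniteSumSample.draws {n S m b : ℕ} [NeZero n] (ζ : FiniteSumSample n S m b) :
    Draw b → Fin n
  | .batch s j => if h : s < S then ζ.1 ⟨s, h⟩ (Fin.ofNat n j) else 0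
  | .inner s t k => if h : s < S ∧ t < m then ζ.2 ⟨s, h.1⟩ ⟨t, h.2⟩ k else 0

/-- The law of the draws in the online setting: independent with law `P`. -/
def onlineLaw {ι : Type*} [MeasurableSpace ι] (P : Measure ι) [IsProbabilityMeasure P] (b : ℕ) :
    Measure (Draw b → ι) :=
  Measure.infinitePi (fun _ : Draw b => P)

end RAbaSVRG

end

/-! Write `a = ‖grad f(x_t)‖²`, `V = ‖v_t‖²`, `e = ‖v_t - grad f(x_t)‖²` and `κ = (L_l + θ G)² μ²
ν²`. Three estimates are played against each other.

Descent: retraction smoothness along `-η v`, with the inner product polarized, lowers `f` at each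
step by at least `η/2 a + η/2 (1 - L η) V - η/2 e` (`obj_retraction_le`). The decreases telescope to
at most `Δ`.

Error: given the past, `v_t - grad f(x_t)` is a centred average of `b = m²` independent terms plus
the transported error of the snapshot. So the mean of `e` exceeds its value at `t = 0` by at most
`1/m²` times the mean-square variation of the component gradients between `x_0` and `x_t`. The
Lipschitz and transport hypotheses bound this variation by `(L_l + θ G)² ‖ξ‖²`. The constants `μ, ν`
compare `‖ξ‖` with the path length `η ∑ ‖v_j‖`, and Cauchy-Schwarz yields `κ η² t ∑_{j<t} V_j`. Over
an epoch the cost is at most `κ η² / 2 · ∑ V`.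

Batch: the batch size rule keeps the mean of `e` at `t = 0` below that of `β_s/4 + ε²/4`. As
`β_{s+1}` is the mean of `V` over epoch `s`, the adaptive batches cost at most a quarter of `∑ V`,
apart from the contribution of `β_1`.

In the sum of the three, `∑ V` has the coefficient `η/2 (3/4 - L η - κ η²/2)`, which the step size
makes nonnegative. What remains is `∑ a ≤ S m ε²` in the mean (`sum_sq_grad_le`), and AM-GM passes
from squared norms to norms.

Conditioning on the past is done by redrawing one block of draws: the law is unchanged and
everything decided earlier stays fixed (`expect_resample` for finite samples,
`integral_le_of_overwrite` for infinite product measures).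

The oracle count is deterministic: `∑ B^s + 2 m³ S`, where `S ≤ 1 + (8/3) Δ Θ / (ε² m)` because `η =
3 / (2 Θ)`. -/

noncomputable section

namespace RAbaSVRG

/-! ### Second moments of averages of random vectors -/

section Sampling

variable {V : Type*} [NormedAddCommGroup V] [InnerProductSpace ℝ V]

/-- The second moment of the average of `k` centred, pairwise nonpositively correlated vectors,
shifted by a constant. -/
theorem integral_norm_sq_average_add_le {Ω : Type*} [MeasurableSpace Ω] {μ : Measure Ω}
    [IsProbabilityMeasure μ] [CompleteSpace V] {k : ℕ} {Z : Fin k → Ω → V} {τ : ℝ}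
    (hZ : ∀ j, MemLp (Z j) 2 μ) (h0 : ∀ j, ∫ w, Z j w ∂μ = 0)
    (hcov : ∀ i j, i ≠ j → ∫ w, inner ℝ (Z i w) (Z j w) ∂μ ≤ 0)
    (hvar : ∀ j, ∫ w, ‖Z j w‖ ^ 2 ∂μ ≤ τ) (c : V) :
    ∫ w, ‖(k : ℝ)⁻¹ • ∑ j, Z j w + c‖ ^ 2 ∂μ ≤ τ / k + ‖c‖ ^ 2 := by
  have hint : ∀ i j, Integrable (fun w => inner ℝ (Z i w) (Z j w)) μ := fun i j =>
    ((hZ i).norm.integrable_mul (hZ j).norm).mono' ((hZ i).1.inner (hZ j).1)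
      (.of_forall fun _ => norm_inner_le_norm _ _)
  have hintc : ∀ j, Integrable (fun w => inner ℝ (Z j w) c) μ := fun j =>
    ((hZ j).integrable (by norm_num)).inner_const c
  have hexp : ∀ w, ‖(k : ℝ)⁻¹ • ∑ j, Z j w + c‖ ^ 2
      = (k : ℝ)⁻¹ ^ 2 * (∑ i, ∑ j, inner ℝ (Z i w) (Z j w))
        + (2 * (k : ℝ)⁻¹ * (∑ j, inner ℝ (Z j w) c) + ‖c‖ ^ 2) := by
    intro w
    rw [norm_add_sq_real, norm_smul, mul_pow, ← real_inner_self_eq_norm_sq (∑ j, Z j w),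
      real_inner_smul_left, sum_inner, sum_inner]
    simp only [inner_sum, Real.norm_eq_abs, sq_abs]
    ring
  simp_rw [hexp]
  rw [integral_add, integral_add, integral_const_mul, integral_const_mul,
    integral_finsetSum _ fun i _ => integrable_finsetSum _ fun j _ => hint i j,
    integral_finsetSum _ fun j _ => hintc j]
  rotate_left
  · exact (integrable_finsetSum _ fun j _ => hintc j).const_mul _
  · exact integrable_const _
  · exact (integrable_finsetSum _ fun i _ => integrable_finsetSum _ fun j _ => hint i j).const_mul _
  · exact ((integrable_finsetSum _ fun j _ => hintc j).const_mul _).add (integrable_const _)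
  have hz : ∀ j, ∫ w, inner ℝ (Z j w) c ∂μ = 0 := fun j => by
    have := integral_inner (𝕜 := ℝ) ((hZ j).integrable (by norm_num)) c
    rw [h0 j, inner_zero_right] at this
    rw [← this]
    exact integral_congr_ae (.of_forall fun w => real_inner_comm _ _)
  -- Each row of the covariance matrix has a diagonal entry at most `τ` and off-diagonal entries at
  -- most `0`.
  have hs : ∑ i, ∫ w, ∑ j, inner ℝ (Z i w) (Z j w) ∂μ ≤ k * τ := by
    calc ∑ i, ∫ w, ∑ j, inner ℝ (Z i w) (Z j w) ∂μ ≤ ∑ _i : Fin k, τ := by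
          refine Finset.sum_le_sum fun i _ => ?_
          rw [integral_finsetSum _ fun j _ => hint i j, ← Finset.add_sum_erase _ _ (Finset.mem_univ i)]
          have h1 : ∑ j ∈ Finset.univ.erase i, ∫ w, inner ℝ (Z i w) (Z j w) ∂μ ≤ 0 :=
            Finset.sum_nonpos fun j hj => hcov i j (Finset.ne_of_mem_erase hj).symm
          have h2 := hvar i
          simp_rw [← real_inner_self_eq_norm_sq] at h2
          linarith
      _ = k * τ := by simp
  -- For `k = 0` both sides vanish, division by zero being zero.
  have hk : (k : ℝ)⁻¹ ^ 2 * (k * τ) = τ / k := by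
    rcases eq_or_ne (k : ℝ) 0 with h | h
    · simp [h]
    · field_simp
  simp only [hz, Finset.sum_const_zero, mul_zero, integral_const, probReal_univ, one_smul, zero_add]
  have := mul_le_mul_of_nonneg_left hs (sq_nonneg (k : ℝ)⁻¹)
  linarith

theorem inv_smul_sum_sub_const {k : ℕ} (hk : 0 < k) (x : Fin k → V) (a : V) :
    (k : ℝ)⁻¹ • ∑ j, (x j - a) = (k : ℝ)⁻¹ • ∑ j, x j - a := by
  have : (k : ℝ) ≠ 0 := by positivity
  rw [Finset.sum_sub_distrib, smul_sub, Finset.sum_const, Finset.card_univ, Fintype.card_fin,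
    ← Nat.cast_smul_eq_nsmul ℝ, smul_smul, inv_mul_cancel₀ this, one_smul]

/-- The second moment of a centred random vector is at most the second moment of the vector. -/
theorem integral_norm_sub_integral_sq_le {ι : Type*} [MeasurableSpace ι] {P : Measure ι}
    [IsProbabilityMeasure P] [CompleteSpace V] {g : ι → V} (hg : MemLp g 2 P) :
    ∫ i, ‖g i - ∫ j, g j ∂P‖ ^ 2 ∂P ≤ ∫ i, ‖g i‖ ^ 2 ∂P := by
  set a := ∫ j, g j ∂P with ha
  have h1 : Integrable (fun i => ‖g i‖ ^ 2) P := hg.integrable_norm_pow (by norm_num)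
  have hgi := hg.integrable (by norm_num : (1 : ℝ≥0∞) ≤ 2)
  have h2 : Integrable (fun i => inner ℝ a (g i)) P := hgi.const_inner a
  have : ∀ i, ‖g i - a‖ ^ 2 = ‖g i‖ ^ 2 - 2 * inner ℝ a (g i) + ‖a‖ ^ 2 := fun i => by
    rw [norm_sub_sq_real, real_inner_comm]
  simp_rw [this]
  rw [integral_add (f := fun i => ‖g i‖ ^ 2 - 2 * inner ℝ a (g i)) (h1.sub (h2.const_mul 2))
      (integrable_const _), integral_sub h1 (h2.const_mul 2),
    integral_const_mul, integral_inner hgi, ← ha, real_inner_self_eq_norm_sq]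
  simp only [integral_const, probReal_univ, one_smul]
  nlinarith [sq_nonneg ‖a‖]

theorem integral_inner_eval_eq_zero {ι κ : Type*} [MeasurableSpace ι] (P : Measure ι)
    [IsProbabilityMeasure P] [CompleteSpace V] {g : ι → V} (hg : MemLp g 2 P)
    (h0 : ∫ i, g i ∂P = 0) {i j : κ} (hij : i ≠ j) :
    ∫ I, inner ℝ (g (I i)) (g (I j)) ∂(Measure.infinitePi fun _ : κ => P) = 0 := by
  have hind : ProbabilityTheory.IndepFun (fun I : κ → ι => I i) (fun I : κ → ι => I j)
      (Measure.infinitePi fun _ : κ => P) :=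
    (ProbabilityTheory.iIndepFun_infinitePi (P := fun _ : κ => P) (X := fun _ x => x)
      (fun _ => measurable_id)).indepFun hij
  have hmap := (ProbabilityTheory.indepFun_iff_map_prod_eq_prod_map_map
    (measurable_pi_apply i).aemeasurable (measurable_pi_apply j).aemeasurable).1 hind
  rw [Measure.infinitePi_map_eval, Measure.infinitePi_map_eval] at hmap
  have hpair : AEMeasurable (fun I : κ → ι => (I i, I j)) (Measure.infinitePi fun _ : κ => P) :=
    ((measurable_pi_apply i).prodMk (measurable_pi_apply j)).aemeasurable
  have hsm : AEStronglyMeasurable (fun p : ι × ι => inner ℝ (g p.1) (g p.2)) (P.prod P) :=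
    (hg.1.comp_fst).inner (hg.1.comp_snd)
  have hgi := hg.integrable (by norm_num : (1 : ℝ≥0∞) ≤ 2)
  have h1 : ∫ I, inner ℝ (g (I i)) (g (I j)) ∂(Measure.infinitePi fun _ : κ => P)
      = ∫ p, inner ℝ (g p.1) (g p.2) ∂(P.prod P) := by
    rw [← hmap, integral_map hpair (hmap ▸ hsm)]
  have hint : Integrable (fun p : ι × ι => inner ℝ (g p.1) (g p.2)) (P.prod P) := by
    refine (hgi.norm.mul_prod hgi.norm).mono' hsm (.of_forall fun p => ?_)
    exact norm_inner_le_norm _ _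
  rw [h1, integral_prod _ hint]
  simp_rw [integral_inner hgi, h0, inner_zero_right, integral_zero]

/-- Mini-batch averages of independent draws. -/
theorem integral_norm_sq_iid_average_le {ι κ : Type*} [MeasurableSpace ι] (P : Measure ι)
    [IsProbabilityMeasure P] [CompleteSpace V] {g : ι → V} (hg : MemLp g 2 P) {k : ℕ} (hk : 0 < k)
    {φ : Fin k → κ} (hφ : φ.Injective) (c : V) :
    ∫ I, ‖(k : ℝ)⁻¹ • ∑ j, g (I (φ j)) - ∫ i, g i ∂P + c‖ ^ 2 ∂(Measure.infinitePi fun _ : κ => P)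
      ≤ (∫ i, ‖g i - ∫ j, g j ∂P‖ ^ 2 ∂P) / k + ‖c‖ ^ 2 := by
  set a := ∫ i, g i ∂P with ha
  have hg' : MemLp (fun i => g i - a) 2 P := hg.sub (memLp_const a)
  have h0 : ∫ i, (g i - a) ∂P = 0 := by
    rw [integral_sub (hg.integrable (by norm_num)) (integrable_const _)]; simp [ha]
  have hmp : ∀ j, MeasurePreserving (fun I : κ → ι => I (φ j)) (Measure.infinitePi fun _ : κ => P) P :=
    fun j => measurePreserving_eval_infinitePi (fun _ : κ => P) (φ j)
  have key := integral_norm_sq_average_add_le (μ := Measure.infinitePi fun _ : κ => P)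
    (Z := fun j I => g (I (φ j)) - a) (τ := ∫ i, ‖g i - a‖ ^ 2 ∂P)
    (fun j => hg'.comp_measurePreserving (hmp j)) (fun j => ?_) (fun i j hij => ?_) (fun j => ?_) c
  · simpa only [inv_smul_sum_sub_const hk] using key
  · have := integral_map (μ := Measure.infinitePi fun _ : κ => P) (hmp j).measurable.aemeasurable
      (f := fun i => g i - a) (by rw [(hmp j).map_eq]; exact hg'.1)
    rw [← this, (hmp j).map_eq, h0]
  · exact (integral_inner_eval_eq_zero P hg' h0 (hφ.ne hij)).le
  · have := integral_map (μ := Measure.infinitePi fun _ : κ => P) (hmp j).measurable.aemeasurable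
      (f := fun i => ‖g i - a‖ ^ 2) (by rw [(hmp j).map_eq]; exact hg'.1.norm.pow 2)
    rw [← this, (hmp j).map_eq]

end Sampling

/-! ### Uniform averages, random permutations and resampling -/

section Finite

theorem integral_uniformOfFintype {α V : Type*} [Fintype α] [Nonempty α] [MeasurableSpace α]
    [MeasurableSingletonClass α] [NormedAddCommGroup V] [NormedSpace ℝ V]
    [CompleteSpace V] (f : α → V) : ∫ a, f a ∂(PMF.uniformOfFintype α).toMeasure = (Fintype.card α : ℝ)⁻¹ • ∑ a, f a := by
  rw [PMF.integral_eq_sum]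
  simp [Finset.smul_sum]

theorem integral_uniformOfFintype_real {α : Type*} [Fintype α] [Nonempty α] [MeasurableSpace α]
    [MeasurableSingletonClass α] (f : α → ℝ) :
    ∫ a, f a ∂(PMF.uniformOfFintype α).toMeasure = Finset.expect Finset.univ f := by
  rw [integral_uniformOfFintype, Fintype.expect_eq_sum_div_card]
  rw [smul_eq_mul, div_eq_inv_mul]

theorem integral_infinitePi_unif {n b : ℕ} [NeZero n] (f : (Fin b → Fin n) → ℝ) :
    ∫ I, f I ∂(Measure.infinitePi fun _ : Fin b => unif n) = Finset.expect Finset.univ f := by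
  have : IsProbabilityMeasure (unif n) := PMF.toMeasure.isProbabilityMeasure _
  rw [integral_fintype (Integrable.of_finite), Fintype.expect_eq_sum_div_card, Finset.sum_div]
  refine Finset.sum_congr rfl fun I _ => ?_
  rw [measureReal_def, Measure.infinitePi_singleton_of_fintype]
  simp [unif, div_eq_inv_mul]

/-- Right multiplication by a transposition permutes the permutations, so the sum on the left does
not depend on `i`. Summed over all positions, each permutation contributes the full sum of `h`. -/
theorem smul_sum_perm_apply {W : Type*} [AddCommGroup W] [Module ℝ W] {n : ℕ} (h : Fin n → W)
    (i : Fin n) : (n : ℝ) • ∑ e : Equiv.Perm (Fin n), h (e i)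
      = (Fintype.card (Equiv.Perm (Fin n)) : ℝ) • ∑ l, h l := by
  have hi : ∀ l, ∑ e : Equiv.Perm (Fin n), h (e l) = ∑ e : Equiv.Perm (Fin n), h (e i) := fun l =>
    Fintype.sum_equiv (Equiv.mulRight (Equiv.swap l i)) _ _ fun e => by simp
  calc (n : ℝ) • ∑ e : Equiv.Perm (Fin n), h (e i)
      = ∑ l, ∑ e : Equiv.Perm (Fin n), h (e l) := by
        simp [hi, Nat.cast_smul_eq_nsmul]
    _ = ∑ e : Equiv.Perm (Fin n), ∑ l, h (e l) := Finset.sum_comm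
    _ = _ := by simp [Equiv.sum_comp, Nat.cast_smul_eq_nsmul]

/-- Averages of samples without replacement of a centred family. -/
theorem expect_norm_sq_perm_average_le {V : Type*} [NormedAddCommGroup V] [InnerProductSpace ℝ V]
    [CompleteSpace V] {n k : ℕ} [NeZero n] {g : Fin n → V}
    (h0 : ∑ i, g i = 0) {φ : Fin k → Fin n} (hφ : φ.Injective) :
    Finset.expect Finset.univ (fun e : Equiv.Perm (Fin n) => ‖(k : ℝ)⁻¹ • ∑ j, g (e (φ j))‖ ^ 2)
      ≤ Finset.expect Finset.univ (fun i => ‖g i‖ ^ 2) / k := by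
  let _ : MeasurableSpace (Equiv.Perm (Fin n)) := ⊤
  have : MeasurableSingletonClass (Equiv.Perm (Fin n)) := ⟨fun _ => trivial⟩
  have hn : (n : ℝ) ≠ 0 := by exact_mod_cast NeZero.ne n
  have hcard : (Fintype.card (Equiv.Perm (Fin n)) : ℝ) ≠ 0 := by
    exact_mod_cast Fintype.card_ne_zero
  have key := integral_norm_sq_average_add_le
    (μ := (PMF.uniformOfFintype (Equiv.Perm (Fin n))).toMeasure)
    (Z := fun j e => g (e (φ j))) (τ := Finset.expect Finset.univ (fun i => ‖g i‖ ^ 2))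
    (fun j => ?_) (fun j => ?_) (fun i j hij => ?_) (fun j => ?_) 0
  · simpa [integral_uniformOfFintype_real] using key
  · exact MemLp.of_discrete
  · rw [integral_uniformOfFintype]
    have := smul_sum_perm_apply g (φ j)
    rw [h0, smul_zero, smul_eq_zero, or_iff_right hn] at this
    rw [this, smul_zero]
  · rw [integral_uniformOfFintype, smul_eq_mul]
    refine mul_nonpos_of_nonneg_of_nonpos (by positivity) ?_
    set p := φ i
    set q := φ j
    have hpq : p ≠ q := hφ.ne hij
    -- By symmetry all off-diagonal entries in the row of `p` are equal. The row sums to zero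
    -- because `g` does, and its diagonal entry is nonnegative, so the common off-diagonal value
    -- cannot be positive.
    have hq : ∀ l, l ≠ p → ∑ e : Equiv.Perm (Fin n), inner ℝ (g (e p)) (g (e l))
        = ∑ e : Equiv.Perm (Fin n), inner ℝ (g (e p)) (g (e q)) := fun l hl =>
      Fintype.sum_equiv (Equiv.mulRight (Equiv.swap l q)) _ _ fun e => by
        simp [Equiv.swap_apply_of_ne_of_ne hl.symm hpq]
    have hsum : ∑ l, ∑ e : Equiv.Perm (Fin n), inner ℝ (g (e p)) (g (e l)) = 0 := by
      rw [Finset.sum_comm]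
      refine Finset.sum_eq_zero fun e _ => ?_
      rw [← inner_sum, Equiv.sum_comp, h0, inner_zero_right]
    rw [← Finset.add_sum_erase _ _ (Finset.mem_univ p),
      Finset.sum_congr rfl fun l hl => hq l (Finset.ne_of_mem_erase hl), Finset.sum_const,
      nsmul_eq_mul] at hsum
    have h1 : 0 ≤ ∑ e : Equiv.Perm (Fin n), inner ℝ (g (e p)) (g (e p)) :=
      Finset.sum_nonneg fun e _ => real_inner_self_nonneg
    have h2 : (0 : ℝ) < (Finset.univ.erase p).card := by
      exact_mod_cast Finset.card_pos.2 ⟨q, Finset.mem_erase.2 ⟨hpq.symm, Finset.mem_univ q⟩⟩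
    by_contra! hcon
    linarith [mul_pos h2 hcon]
  · rw [integral_uniformOfFintype, Fintype.expect_eq_sum_div_card, smul_eq_mul]
    have := smul_sum_perm_apply (fun i => ‖g i‖ ^ 2) (φ j)
    simp only [smul_eq_mul] at this
    rw [Fintype.card_fin]
    refine le_of_eq ?_
    field_simp
    linarith

/-- Averaging over a resampled component does not change the expectation. -/
theorem expect_resample {α κ : Type*} [Fintype α] [Fintype κ] [Nonempty κ]
    (Φ : α → κ → α) (Ψ : α → κ) (h1 : ∀ a k, Φ (Φ a k) (Ψ a) = a) (h2 : ∀ a k, Ψ (Φ a k) = k)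
    (h : α → ℝ) :
    Finset.expect Finset.univ (fun a => Finset.expect Finset.univ fun k => h (Φ a k))
      = Finset.expect Finset.univ h := by
  -- Exchanging the component stored in `a` with the fresh one is an involution of `α × κ`, hence
  -- preserves sums over pairs.
  have hinv : Function.Involutive fun p : α × κ => (Φ p.1 p.2, Ψ p.1) := fun p => by
    simp [h1, h2]
  have : ∑ p : α × κ, h (Φ p.1 p.2) = ∑ p : α × κ, h p.1 :=
    Fintype.sum_equiv hinv.toPerm _ _ fun p => rfl
  rw [Fintype.sum_prod_type, Fintype.sum_prod_type] at this
  simp only [Finset.sum_const, Finset.card_univ, nsmul_eq_mul, ← Finset.mul_sum] at this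
  simp only [Fintype.expect_eq_sum_div_card, ← Finset.sum_div]
  rw [this]
  have : (Fintype.card κ : ℝ) ≠ 0 := by exact_mod_cast Fintype.card_ne_zero
  field_simp

end Finite

/-! ### Resampling a block of coordinates of an infinite product -/

section Resample

variable {δ κ ι : Type*}

open Classical in
/-- Overwrite the coordinates in the range of `emb`. -/
def overwrite (emb : κ → δ) (ζ : δ → ι) (I : κ → ι) (d : δ) : ι :=
  if h : ∃ k, emb k = d then I h.choose else ζ d

theorem overwrite_apply {emb : κ → δ} (hemb : emb.Injective) (ζ : δ → ι) (I : κ → ι) (k : κ) :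
    overwrite emb ζ I (emb k) = I k := by
  have h : ∃ k', emb k' = emb k := ⟨k, rfl⟩
  rw [overwrite, dif_pos h, hemb h.choose_spec]

theorem overwrite_of_notMem {emb : κ → δ} {d : δ} (hd : ∀ k, emb k ≠ d) (ζ : δ → ι) (I : κ → ι) :
    overwrite emb ζ I d = ζ d := by
  rw [overwrite, dif_neg (by simpa using hd)]

theorem measurable_overwrite [MeasurableSpace ι] (emb : κ → δ) :
    Measurable fun p : (δ → ι) × (κ → ι) => overwrite emb p.1 p.2 := by
  refine measurable_pi_lambda _ fun d => ?_
  by_cases h : ∃ k, emb k = d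
  · simp only [overwrite, dif_pos h]
    exact (measurable_pi_apply _).comp measurable_snd
  · simp only [overwrite, dif_neg h]
    exact (measurable_pi_apply _).comp measurable_fst

theorem measurePreserving_overwrite [MeasurableSpace ι] (P : Measure ι) [IsProbabilityMeasure P] {emb : κ → δ}
    (hemb : emb.Injective) :
    MeasurePreserving (fun p : (δ → ι) × (κ → ι) => overwrite emb p.1 p.2)
      ((Measure.infinitePi fun _ : δ => P).prod (Measure.infinitePi fun _ : κ => P))
      (Measure.infinitePi fun _ : δ => P) := by
  classical
  refine ⟨measurable_overwrite emb, Measure.eq_infinitePi _ fun s t ht => ?_⟩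
  have hms : MeasurableSet (Set.pi (s : Set δ) t) :=
    MeasurableSet.pi s.countable_toSet fun i _ => ht i
  rw [Measure.map_apply (measurable_overwrite emb) hms]
  set s₁ := s.filter fun d => ∃ k, emb k = d with hs₁
  set s₂ := s.filter fun d => ¬ ∃ k, emb k = d with hs₂
  -- Finite boxes determine the product measure. The preimage of a box splits into a box on the old
  -- coordinates outside the block and a box on the fresh ones; the latter is finite, since `emb` is
  -- injective, even when `κ` is infinite.
  have hpre : (fun p : (δ → ι) × (κ → ι) => overwrite emb p.1 p.2) ⁻¹' Set.pi (s : Set δ) t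
      = Set.pi (s₂ : Set δ) t ×ˢ
        Set.pi ((s.preimage emb hemb.injOn : Finset κ) : Set κ) (fun k => t (emb k)) := by
    ext ⟨ζ, I⟩
    simp only [mem_preimage, Set.mem_pi, mem_prod, Finset.mem_coe, Finset.mem_preimage, hs₂,
      Finset.mem_filter]
    constructor
    · intro h
      refine ⟨fun d hd => ?_, fun k hk => ?_⟩
      · rw [← overwrite_of_notMem (by simpa using hd.2) ζ I]; exact h d hd.1
      · rw [← overwrite_apply hemb ζ I k]; exact h _ hk
    · rintro ⟨h1, h2⟩ d hd
      by_cases hk : ∃ k, emb k = d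
      · obtain ⟨k, rfl⟩ := hk
        rw [overwrite_apply hemb]; exact h2 k hd
      · rw [overwrite_of_notMem (by simpa using hk)]; exact h1 d ⟨hd, hk⟩
  rw [hpre, Measure.prod_prod, Measure.infinitePi_pi _ fun i _ => ht i,
    Measure.infinitePi_pi _ fun k _ => ht (emb k)]
  rw [← Finset.prod_filter_mul_prod_filter_not s (fun d => ∃ k, emb k = d), mul_comm]
  congr 1
  rw [Finset.prod_preimage' emb s hemb.injOn fun d => P (t d)]
  simp only [Set.mem_range]

/-- If, for almost every `ζ`, the average of `h` over a resampling of the block `emb` is at most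
`r ζ`, then `∫ h ≤ ∫ r`. -/
theorem integral_le_of_overwrite [MeasurableSpace ι] (P : Measure ι) [IsProbabilityMeasure P] {emb : κ → δ}
    (hemb : emb.Injective) {h r : (δ → ι) → ℝ} (hh : Integrable h (Measure.infinitePi fun _ : δ => P))
    (hr : Integrable r (Measure.infinitePi fun _ : δ => P))
    (hle : ∀ᵐ ζ ∂(Measure.infinitePi fun _ : δ => P),
      ∫ I, h (overwrite emb ζ I) ∂(Measure.infinitePi fun _ : κ => P) ≤ r ζ) :
    ∫ ζ, h ζ ∂(Measure.infinitePi fun _ : δ => P) ≤ ∫ ζ, r ζ ∂(Measure.infinitePi fun _ : δ => P) := by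
  have hmp := measurePreserving_overwrite P hemb
  have hint : Integrable (fun p : (δ → ι) × (κ → ι) => h (overwrite emb p.1 p.2))
      ((Measure.infinitePi fun _ : δ => P).prod (Measure.infinitePi fun _ : κ => P)) :=
    hmp.integrable_comp_of_integrable hh
  have heq : ∫ ζ, h ζ ∂(Measure.infinitePi fun _ : δ => P)
      = ∫ ζ, ∫ I, h (overwrite emb ζ I) ∂(Measure.infinitePi fun _ : κ => P)
          ∂(Measure.infinitePi fun _ : δ => P) := by
    rw [← integral_prod _ hint]
    conv_lhs => rw [← hmp.map_eq]
    exact integral_map hmp.measurable.aemeasurable (by rw [hmp.map_eq]; exact hh.1)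
  rw [heq]
  exact integral_mono_ae hint.integral_prod_left hr hle

end Resample

/-! ### Step size, summation over epochs, oracle counts and batch sizes -/

section Arithmetic

/-- With `q = √(L² + 3κ)` the expression equals `3 (q - L) / (8 (L + q))`. The exact positive root
of the quadratic has `3κ/2` under the square root; the larger `3κ` shortens the step. -/
theorem stepSize_condition {L κ η : ℝ} (hL : 0 < L) (hκ : 0 ≤ κ)
    (hη : η = 3 / (2 * L + 2 * √(L ^ 2 + 3 * κ))) : 0 ≤ 3 / 4 - L * η - κ * η ^ 2 / 2 := by
  set q := √(L ^ 2 + 3 * κ) with hq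
  have hq2 : q ^ 2 = L ^ 2 + 3 * κ := Real.sq_sqrt (by positivity)
  have hLq : L ≤ q := Real.le_sqrt_of_sq_le (by linarith)
  have hκ' : κ = (q ^ 2 - L ^ 2) / 3 := by linarith
  have hpos : 0 < L + q := by linarith
  have : 3 / 4 - L * η - κ * η ^ 2 / 2 = 3 * (q - L) / (8 * (L + q)) := by
    rw [hη, hκ', show 2 * L + 2 * q = 2 * (L + q) by ring]
    field_simp
    ring
  rw [this]
  exact div_nonneg (by linarith) (by linarith)

/-- Summation of the descent, the variance and the batch size estimates over all epochs. -/
theorem sum_sq_grad_le {S m : ℕ} {a V e : ℕ → ℕ → ℝ} {β : ℕ → ℝ} {η L κ ε Δ : ℝ} (hm : 0 < m)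
    (hη : 0 < η) (hκ : 0 ≤ κ) (hV : ∀ s t, 0 ≤ V s t)
    (hcond : 0 ≤ 3 / 4 - L * η - κ * η ^ 2 / 2)
    (hdesc : ∑ s ∈ Finset.range S, ∑ t ∈ Finset.range m,
      (η / 2 * a s t + (η / 2 - L * η ^ 2 / 2) * V s t - η / 2 * e s t) ≤ Δ)
    (he : ∀ s < S, ∀ t < m,
      e s t ≤ e s 0 + κ * η ^ 2 / (m : ℝ) ^ 2 * (t * ∑ j ∈ Finset.range t, V s j))
    (h0 : ∀ s < S, e s 0 ≤ β s / 4 + ε ^ 2 / 4)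
    (hβ : ∀ s, s + 1 < S → β (s + 1) = (∑ t ∈ Finset.range m, V s t) / m)
    (hβ0 : β 0 ≤ ε ^ 2 * S) (hS : 4 * Δ ≤ S * (ε ^ 2 * m * η)) :
    ∑ s ∈ Finset.range S, ∑ t ∈ Finset.range m, a s t ≤ S * m * ε ^ 2 := by
  have hm' : (0 : ℝ) < m := by exact_mod_cast hm
  set W : ℕ → ℝ := fun s => ∑ t ∈ Finset.range m, V s t with hW
  have hW0 : ∀ s, 0 ≤ W s := fun s => Finset.sum_nonneg fun t _ => hV s t
  have hepoch : ∀ s < S, ∑ t ∈ Finset.range m, e s t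
      ≤ m * (β s / 4 + ε ^ 2 / 4) + κ * η ^ 2 / 2 * W s := by
    intro s hs
    have h1 : ∀ t ∈ Finset.range m,
        e s t ≤ (β s / 4 + ε ^ 2 / 4) + κ * η ^ 2 / (m : ℝ) ^ 2 * W s * t := by
      intro t ht
      have ht := Finset.mem_range.1 ht
      have h2 : ∑ j ∈ Finset.range t, V s j ≤ W s :=
        Finset.sum_le_sum_of_subset_of_nonneg (Finset.range_mono ht.le) fun j _ _ => hV s j
      have h3 : κ * η ^ 2 / (m : ℝ) ^ 2 * (t * ∑ j ∈ Finset.range t, V s j)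
          ≤ κ * η ^ 2 / (m : ℝ) ^ 2 * (t * W s) := by gcongr
      linarith [he s hs t ht, h0 s hs]
    have h4 : ∑ t ∈ Finset.range m, (t : ℝ) ≤ (m : ℝ) ^ 2 / 2 := by
      clear_value W
      clear * -
      induction m with
      | zero => simp
      | succ k ih => rw [Finset.sum_range_succ]; push_cast; nlinarith
    have h5 : κ * η ^ 2 / (m : ℝ) ^ 2 * W s * ∑ t ∈ Finset.range m, (t : ℝ)
        ≤ κ * η ^ 2 / (m : ℝ) ^ 2 * W s * ((m : ℝ) ^ 2 / 2) := by
      gcongr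
      exact mul_nonneg (by positivity) (hW0 s)
    calc ∑ t ∈ Finset.range m, e s t
        ≤ ∑ t ∈ Finset.range m,
            ((β s / 4 + ε ^ 2 / 4) + κ * η ^ 2 / (m : ℝ) ^ 2 * W s * t) := Finset.sum_le_sum h1
      _ = m * (β s / 4 + ε ^ 2 / 4)
            + κ * η ^ 2 / (m : ℝ) ^ 2 * W s * ∑ t ∈ Finset.range m, (t : ℝ) := by
          rw [Finset.sum_add_distrib, ← Finset.mul_sum]; simp [mul_add]
      _ ≤ _ := by
          have : κ * η ^ 2 / (m : ℝ) ^ 2 * W s * ((m : ℝ) ^ 2 / 2) = κ * η ^ 2 / 2 * W s := by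
            field_simp
          linarith
  -- Shift of index: `β (s + 1)` is paid for by the directions of epoch `s`, and `β 0` by its
  -- assumed bound. The directions of the last epoch determine no batch, so their nonnegative sum is
  -- simply added.
  have hβsum : m * ∑ s ∈ Finset.range S, β s ≤ m * (ε ^ 2 * S) + ∑ s ∈ Finset.range S, W s := by
    cases S with
    | zero => simp
    | succ k =>
      rw [Finset.sum_range_succ' β, Finset.sum_range_succ W, mul_add, Finset.mul_sum]
      have h1 : ∑ s ∈ Finset.range k, m * β (s + 1) = ∑ s ∈ Finset.range k, W s :=
        Finset.sum_congr rfl fun s hs => by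
          rw [hβ s (by have := Finset.mem_range.1 hs; omega), mul_div_cancel₀ _ hm'.ne']
      rw [h1]
      have := mul_le_mul_of_nonneg_left hβ0 hm'.le
      linarith [hW0 k]
  have hE : ∑ s ∈ Finset.range S, ∑ t ∈ Finset.range m, e s t
      ≤ m * (∑ s ∈ Finset.range S, β s) / 4 + m * S * ε ^ 2 / 4
        + κ * η ^ 2 / 2 * ∑ s ∈ Finset.range S, W s := by
    calc _ ≤ ∑ s ∈ Finset.range S, (m * (β s / 4 + ε ^ 2 / 4) + κ * η ^ 2 / 2 * W s) :=
          Finset.sum_le_sum fun s hs => hepoch s (Finset.mem_range.1 hs)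
      _ = _ := by
          rw [Finset.sum_add_distrib, ← Finset.mul_sum, ← Finset.mul_sum, Finset.sum_add_distrib,
            ← Finset.sum_div]
          simp; ring
  have hd : η / 2 * ∑ s ∈ Finset.range S, ∑ t ∈ Finset.range m, a s t
      + (η / 2 - L * η ^ 2 / 2) * ∑ s ∈ Finset.range S, W s
      - η / 2 * ∑ s ∈ Finset.range S, ∑ t ∈ Finset.range m, e s t ≤ Δ := by
    simp only [Finset.sum_add_distrib, Finset.sum_sub_distrib, ← Finset.mul_sum] at hdesc
    exact hdesc
  have hWs : 0 ≤ ∑ s ∈ Finset.range S, W s := Finset.sum_nonneg fun s _ => hW0 s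
  -- The factor `3/4 - L η - κ η²/2` of `η/2 · ∑ W` is `1 - L η` from the descent, less `κ η²/2`
  -- from the drift and `1/4` from the batch sizes. The remaining terms are `1/2` (from `Δ`), `1/4`
  -- (from `β 0`) and `1/4` (from `ε²/4`) of `S m ε²`.
  have h6 := mul_nonneg (mul_nonneg hcond hWs) (half_pos hη).le
  have h7 := mul_le_mul_of_nonneg_left hE (half_pos hη).le
  have h8 := mul_le_mul_of_nonneg_left hβsum (half_pos hη).le
  refine le_of_mul_le_mul_left ?_ (half_pos hη)
  linarith

theorem numEpochs_pos (Δ ε η : ℝ) (m : ℕ) : 0 < numEpochs Δ ε η m :=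
  lt_of_lt_of_le one_pos (le_max_left _ _)

theorem le_numEpochs_mul {Δ ε η : ℝ} {m : ℕ} (h : 0 < ε ^ 2 * m * η) :
    4 * Δ ≤ numEpochs Δ ε η m * (ε ^ 2 * m * η) := by
  rw [← div_le_iff₀ h]
  exact (Nat.le_ceil _).trans (by exact_mod_cast le_max_right _ _)

theorem numEpochs_le {Δ ε η : ℝ} {m : ℕ} (hΔ : 0 ≤ Δ) (h : 0 < ε ^ 2 * m * η) :
    (numEpochs Δ ε η m : ℝ) ≤ 1 + 4 * Δ / (ε ^ 2 * m * η) := by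
  have h0 : 0 ≤ 4 * Δ / (ε ^ 2 * m * η) := by positivity
  rw [numEpochs, Nat.cast_max, max_le_iff]
  exact ⟨by simpa using h0, by linarith [Nat.ceil_lt_add_one h0]⟩

theorem numEpochs_le_two_mul {Δ ε η : ℝ} {m : ℕ} (hΔ : 0 ≤ Δ) (h : 0 < ε ^ 2 * m * η)
    (hle : ε ^ 2 * m * η ≤ 4 * Δ) :
    (numEpochs Δ ε η m : ℝ) ≤ 2 * (4 * Δ / (ε ^ 2 * m * η)) := by
  have := numEpochs_le hΔ h
  have h1 : 1 ≤ 4 * Δ / (ε ^ 2 * m * η) := (one_le_div h).2 hle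
  linarith

/-- Oracle calls, finite-sum setting, with `p = n ^ (1 / 3)` and `A = Δ Θ / ε²`. -/
theorem calls_bound_finite {S m p A B : ℝ} (hm : 0 < m) (hmp : m ≤ p) (hpm : p ≤ 2 * m)
    (hA : 0 ≤ A) (hB : 0 ≤ B) :
    (S ≤ 16 / 3 * (A / m) → S * B + 2 * m ^ 3 * S ≤ 48 * (B + A * B / p + A * p ^ 2)) ∧
    (S ≤ 1 + 8 / 3 * (A / m) →
      S * B + 2 * m ^ 3 * S ≤ 48 * (p ^ 3 + B + A * B / p + A * p ^ 2)) := by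
  have hp : 0 < p := hm.trans_le hmp
  have h1 : A / m * B ≤ 2 * (A * B / p) := by
    rw [div_mul_eq_mul_div, mul_div_assoc', div_le_div_iff₀ hm hp]
    nlinarith [mul_nonneg hA hB]
  have h2 : m ^ 3 * (A / m) ≤ A * p ^ 2 := by
    have : m ^ 3 * (A / m) = A * m ^ 2 := by field_simp
    rw [this]; gcongr
  have h3 : m ^ 3 ≤ p ^ 3 := by gcongr
  have h4 : 0 ≤ A * B / p := by positivity
  have h5 : 0 ≤ A * p ^ 2 := by positivity
  have hm3 : 0 < m ^ 3 := by positivity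
  constructor <;> intro hS
  · have := mul_le_mul_of_nonneg_right hS hB
    have := mul_le_mul_of_nonneg_right hS hm3.le
    linarith
  · have := mul_le_mul_of_nonneg_right hS hB
    have := mul_le_mul_of_nonneg_right hS hm3.le
    linarith

/-- Oracle calls, online setting, with `p = (σ / ε) ^ (2 / 3)` and `A = Δ Θ / ε²`. -/
theorem calls_bound_online {S m p A B : ℝ} (hp : 0 < p) (hpm : p ≤ m) (hmp : m = 1 ∨ m ≤ 2 * p)
    (hA : 0 ≤ A) (hB : 1 ≤ B) :
    (S ≤ 16 / 3 * (A / m) → S * B + 2 * m ^ 3 * S ≤ 48 * (A * B / p + A * p ^ 2)) ∧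
    (S ≤ 1 + 8 / 3 * (A / m) →
      S * B + 2 * m ^ 3 * S ≤ 48 * (p ^ 3 + B + A * B / p + A * p ^ 2)) := by
  have hm : 0 < m := hp.trans_le hpm
  have h1 : A / m * B ≤ A * B / p := by
    rw [div_mul_eq_mul_div]
    exact div_le_div_of_nonneg_left (by positivity) hp hpm
  have h4 : 0 ≤ A * B / p := by positivity
  have h5 : 0 ≤ A * p ^ 2 := by positivity
  have hm3 : 0 < m ^ 3 := by positivity
  have h2 : m ^ 3 * (A / m) ≤ A * B / p + 4 * (A * p ^ 2) := by
    have : m ^ 3 * (A / m) = A * m ^ 2 := by field_simp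
    rw [this]
    -- When `m = 1`, `p` may be tiny and `A m² = A` is not controlled by `A p²`. It is absorbed by
    -- `A B / p`, since `B ≥ 1` and `p ≤ 1`.
    rcases hmp with h | h
    · subst h
      have : A / 1 * 1 ≤ A / 1 * B := by gcongr
      linarith
    · have : A * m ^ 2 ≤ A * (2 * p) ^ 2 := by gcongr
      linarith
  have h3 : m ^ 3 ≤ B + 8 * p ^ 3 := by
    rcases hmp with h | h
    · subst h; nlinarith [pow_pos hp 3]
    · have : m ^ 3 ≤ (2 * p) ^ 3 := by gcongr
      linarith
  have hp3 := pow_pos hp 3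
  constructor <;> intro hS
  · have := mul_le_mul_of_nonneg_right hS (by linarith : 0 ≤ B)
    have := mul_le_mul_of_nonneg_right hS hm3.le
    linarith
  · have := mul_le_mul_of_nonneg_right hS (by linarith : 0 ≤ B)
    have := mul_le_mul_of_nonneg_right hS hm3.le
    linarith

theorem finiteSumBatchSize_pos {α₁ σ β : ℝ} {n : ℕ} [NeZero n] (hα : 4 ≤ α₁) (hσ : 0 < σ)
    (hβ : 0 ≤ β) : 0 < finiteSumBatchSize α₁ σ n β := by
  have hn : (0 : ℝ) < n := by exact_mod_cast NeZero.pos n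
  unfold finiteSumBatchSize
  split_ifs with h
  · exact NeZero.pos n
  · have : 0 < β := lt_of_le_of_ne hβ (Ne.symm h)
    exact Nat.ceil_pos.2 (lt_min (by positivity) hn)

theorem finiteSumBatchSize_le (α₁ σ : ℝ) (n : ℕ) (β : ℝ) : finiteSumBatchSize α₁ σ n β ≤ n := by
  unfold finiteSumBatchSize
  split_ifs with h
  · exact le_rfl
  · exact Nat.ceil_le.2 (min_le_right _ _)

/-- A batch smaller than `n` means that the minimum is `α₁ σ² / β`, and `α₁ ≥ 4`. The full batch is
excluded because it has no sampling error to bound. -/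
theorem sq_div_finiteSumBatchSize_le {α₁ σ β : ℝ} {n : ℕ} [NeZero n] (hα : 4 ≤ α₁) (hσ : 0 < σ)
    (hβ : 0 ≤ β) (hlt : finiteSumBatchSize α₁ σ n β < n) :
    σ ^ 2 / finiteSumBatchSize α₁ σ n β ≤ β / 4 := by
  have hpos : (0 : ℝ) < finiteSumBatchSize α₁ σ n β := by
    exact_mod_cast finiteSumBatchSize_pos hα hσ hβ
  have hβ0 : β ≠ 0 := by
    rintro rfl
    simp [finiteSumBatchSize] at hlt
  have hβ' : 0 < β := lt_of_le_of_ne hβ (Ne.symm hβ0)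
  have hle : α₁ * σ ^ 2 / β ≤ finiteSumBatchSize α₁ σ n β := by
    unfold finiteSumBatchSize at hlt ⊢
    rw [if_neg hβ0] at hlt ⊢
    rcases le_total (α₁ * σ ^ 2 / β) n with h | h
    · rw [min_eq_left h]; exact Nat.le_ceil _
    · rw [min_eq_right h, Nat.ceil_natCast] at hlt; exact absurd hlt (lt_irrefl _)
  rw [div_le_iff₀ hβ'] at hle
  rw [div_le_iff₀ hpos]
  nlinarith [sq_nonneg σ]

theorem onlineBatchSize_pos {α₁ α₂ σ ε β : ℝ} (hα₁ : 4 ≤ α₁) (hα₂ : 4 ≤ α₂) (hσ : 0 < σ)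
    (hε : 0 < ε) (hβ : 0 ≤ β) : 0 < onlineBatchSize α₁ α₂ σ ε β := by
  unfold onlineBatchSize
  split_ifs with h
  · exact Nat.ceil_pos.2 (by positivity)
  · have : 0 < β := lt_of_le_of_ne hβ (Ne.symm h)
    exact Nat.ceil_pos.2 (lt_min (by positivity) (by positivity))

/-- The term of the minimum that is attained decides which summand suffices: `α₁ ≥ 4` yields `β /
4`, and `α₂ ≥ 4` yields `ε² / 4`. -/
theorem sq_div_onlineBatchSize_le {α₁ α₂ σ ε β : ℝ} (hα₁ : 4 ≤ α₁) (hα₂ : 4 ≤ α₂) (hσ : 0 < σ)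
    (hε : 0 < ε) (hβ : 0 ≤ β) :
    σ ^ 2 / onlineBatchSize α₁ α₂ σ ε β ≤ β / 4 + ε ^ 2 / 4 := by
  have hpos : (0 : ℝ) < onlineBatchSize α₁ α₂ σ ε β := by
    exact_mod_cast onlineBatchSize_pos hα₁ hα₂ hσ hε hβ
  have hε2 : 0 < ε ^ 2 := by positivity
  have hσ2 : 0 < σ ^ 2 := by positivity
  rw [div_le_iff₀ hpos]
  have hor : (0 < β ∧ α₁ * σ ^ 2 / β ≤ onlineBatchSize α₁ α₂ σ ε β) ∨
      α₂ * σ ^ 2 / ε ^ 2 ≤ onlineBatchSize α₁ α₂ σ ε β := by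
    unfold onlineBatchSize
    split_ifs with h
    · exact .inr (Nat.le_ceil _)
    · rcases le_total (α₁ * σ ^ 2 / β) (α₂ * σ ^ 2 / ε ^ 2) with h' | h'
      · rw [min_eq_left h']; exact .inl ⟨lt_of_le_of_ne hβ (Ne.symm h), Nat.le_ceil _⟩
      · rw [min_eq_right h']; exact .inr (Nat.le_ceil _)
  generalize (onlineBatchSize α₁ α₂ σ ε β : ℝ) = B at *
  rcases hor with ⟨hβ', h⟩ | h
  · rw [div_le_iff₀ hβ'] at h
    nlinarith [mul_pos hpos hε2]
  · rw [div_le_iff₀ hε2] at h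
    nlinarith [mul_nonneg hpos.le hβ]

end Arithmetic

/-! ### Retractions on totally retractive sets -/

section RetractionGeometry

variable {E : Type*} [NormedAddCommGroup E] [NormedSpace ℝ E]
  {M : Type*} [EMetricSpace M] [ChartedSpace E M]

theorem IsRetraction.continuous_ray [IsManifold 𝓘(ℝ, E) ∞ M] {R : ∀ x : M, TangentSpace 𝓘(ℝ, E) x → M}
    (hR : IsRetraction R) (x : M) (ξ : TangentSpace 𝓘(ℝ, E) x) :
    Continuous fun τ : ℝ => R x (τ • ξ) := by
  have h1 : Continuous fun p : TangentBundle 𝓘(ℝ, E) M => R p.1 p.2 := hR.smooth.continuous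
  have h2 : Continuous (@TotalSpace.mk M E (TangentSpace 𝓘(ℝ, E) : M → Type _) x) :=
    FiberBundle.continuous_totalSpaceMk E (TangentSpace 𝓘(ℝ, E) : M → Type _) x
  have h3 : Continuous fun τ : ℝ => τ • ξ := continuous_id.smul continuous_const
  exact h1.comp (h2.comp h3)

variable [RiemannianBundle (fun x : M => TangentSpace 𝓘(ℝ, E) x)]

theorem IsTotallyRetractive.exists_inverse {R : ∀ x : M, TangentSpace 𝓘(ℝ, E) x → M} {X : Set M}
    {r : ℝ≥0∞} (h : IsTotallyRetractive R X r) {x y : M} (hx : x ∈ X) (hy : y ∈ X) :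
    ∃ ξ : TangentSpace 𝓘(ℝ, E) x, ‖ξ‖ₑ < r ∧ R x ξ = y := by
  obtain ⟨e, hs, he, hX, -, -⟩ := h.2 x hx
  have hmem := e.map_target (hX hy)
  refine ⟨e.symm y, ?_, ?_⟩
  · rw [hs] at hmem; exact hmem
  · rw [← he hmem, e.right_inv (hX hy)]

/-- A ray whose image under the retraction stays in a totally retractive set stays in the ball on
which the retraction is a diffeomorphism. -/
theorem IsTotallyRetractive.enorm_lt [IsManifold 𝓘(ℝ, E) ∞ M] {R : ∀ x : M, TangentSpace 𝓘(ℝ, E) x → M} {X : Set M}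
    {r : ℝ≥0∞} (h : IsTotallyRetractive R X r) (hR : IsRetraction R) {x : M} (hx : x ∈ X)
    {ξ : TangentSpace 𝓘(ℝ, E) x} (hray : ∀ τ ∈ Icc (0 : ℝ) 1, R x (τ • ξ) ∈ X) : ‖ξ‖ₑ < r := by
  obtain ⟨e, hs, he, hX, -, -⟩ := h.2 x hx
  by_contra! hcon
  have hrtop : r ≠ ⊤ := ne_top_of_le_ne_top enorm_ne_top hcon
  have hr : 0 < r.toReal := ENNReal.toReal_pos h.1.ne' hrtop
  have hsource : ∀ v : TangentSpace 𝓘(ℝ, E) x, v ∈ e.source ↔ ‖v‖ < r.toReal := fun v => by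
    rw [hs, mem_ofPred_eq, ← ENNReal.toReal_lt_toReal enorm_ne_top hrtop, toReal_enorm]
  have hcon' : r.toReal ≤ ‖ξ‖ := by
    rw [← toReal_enorm ξ]; exact ENNReal.toReal_mono enorm_ne_top hcon
  have hξ : 0 < ‖ξ‖ := hr.trans_le hcon'
  -- At time `τ` the ray meets the sphere of radius `r`. Before `τ` the inverse chart `e.symm`
  -- recovers the ray from its image; by continuity it does so at `τ` too, where the value should
  -- lie in the open ball but has norm exactly `r`.
  set τ := r.toReal / ‖ξ‖ with hτ
  have hτ0 : 0 < τ := div_pos hr hξ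
  have hτ1 : τ ≤ 1 := (div_le_one hξ).2 hcon'
  have hy := hX (hray τ ⟨hτ0.le, hτ1⟩)
  have hlim1 : Filter.Tendsto (fun t : ℝ => e.symm (R x (t • ξ))) (𝓝[<] τ) (𝓝 (e.symm (R x (τ • ξ)))) :=
    ((e.continuousAt_symm hy).comp (f := fun t : ℝ => R x (t • ξ))
      (hR.continuous_ray x ξ).continuousAt).continuousWithinAt
  have hc : Continuous fun t : ℝ => t • ξ := continuous_id.smul continuous_const
  have hlim2 : Filter.Tendsto (fun t : ℝ => t • ξ) (𝓝[<] τ) (𝓝 (τ • ξ)) :=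
    hc.continuousAt.continuousWithinAt
  have heq : (fun t : ℝ => e.symm (R x (t • ξ))) =ᶠ[𝓝[<] τ] fun t => t • ξ := by
    filter_upwards [Ioo_mem_nhdsLT hτ0] with t ht
    have hmem : t • ξ ∈ e.source := by
      rw [hsource, norm_smul, Real.norm_of_nonneg ht.1.le]
      exact (lt_div_iff₀ hξ).1 ht.2
    rw [← he hmem, e.left_inv hmem]
  have h1 : e.symm (R x (τ • ξ)) = τ • ξ := tendsto_nhds_unique (hlim1.congr' heq) hlim2
  have h2 := e.map_target hy
  rw [h1, hsource, norm_smul, Real.norm_of_nonneg hτ0.le, hτ, div_mul_cancel₀ _ hξ.ne'] at h2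
  exact lt_irrefl _ h2

end RetractionGeometry

/-! ### One-step estimates: Lipschitz bound, descent and conditional variance -/

namespace Problem

variable {E : Type*} [NormedAddCommGroup E] [NormedSpace ℝ E] [FiniteDimensional ℝ E]
  {M : Type*} [EMetricSpace M] [ChartedSpace E M] [IsManifold 𝓘(ℝ, E) ∞ M]
  [RiemannianBundle (fun x : M => TangentSpace 𝓘(ℝ, E) x)]
  {ι : Type*} [MeasurableSpace ι] {D : Problem E M ι} {P : Measure ι}

/-- The component gradients are measurable in the sample and unbiased. -/
structure IsUnbiased (D : Problem E M ι) (P : Measure ι) : Prop where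
  measurable_grad : ∀ x ∈ D.X, AEStronglyMeasurable (fun i => grad (E := E) (D.F i) x) P
  unbiased : ∀ x ∈ D.X, ∫ i, grad (E := E) (D.F i) x ∂P = grad (E := E) (D.obj P) x

theorem IsUnbiased.norm_grad_le [IsProbabilityMeasure P] (hO : D.IsUnbiased P)
    (hA : D.Assumptions P) {x : M} (hx : x ∈ D.X) : ‖grad (E := E) (D.obj P) x‖ ≤ D.G := by
  rw [← hO.unbiased x hx]
  simpa using norm_integral_le_of_norm_le_const (μ := P) (.of_forall fun i => hA.grad_bound x hx i)

theorem IsUnbiased.memLp_grad [IsProbabilityMeasure P] (hO : D.IsUnbiased P)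
    (hA : D.Assumptions P) {x : M} (hx : x ∈ D.X) :
    MemLp (fun i => grad (E := E) (D.F i) x) 2 P :=
  MemLp.of_bound (hO.measurable_grad x hx) D.G (.of_forall fun i => hA.grad_bound x hx i)

theorem IsUnbiased.memLp_transport_sub [IsProbabilityMeasure P] (hO : D.IsUnbiased P)
    (hA : D.Assumptions P) {x y : M} (hx : x ∈ D.X) (hy : y ∈ D.X) :
    MemLp (fun i => grad (E := E) (D.F i) y - D.T x y (grad (D.F i) x)) 2 P :=
  (hO.memLp_grad hA hy).sub
    ((D.T x y).toContinuousLinearMap.comp_memLp' (hO.memLp_grad hA hx))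

theorem norm_batchGrad_le (hA : D.Assumptions P) {x : M} (hx : x ∈ D.X) {k : ℕ} (I : Fin k → ι) :
    ‖D.batchGrad I x‖ ≤ D.G := by
  rw [batchGrad, norm_smul, norm_inv, Real.norm_natCast]
  have h1 : ‖∑ j, grad (E := E) (D.F (I j)) x‖ ≤ k * D.G := by
    refine (norm_sum_le _ _).trans ((Finset.sum_le_sum fun j _ => hA.grad_bound x hx (I j)).trans ?_)
    simp
  have hG := hA.pos.1.le
  rcases Nat.eq_zero_or_pos k with rfl | hk
  · simpa using hG
  · have hk' : (0 : ℝ) < k := by exact_mod_cast hk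
    rw [inv_mul_le_iff₀ hk']
    exact h1

theorem norm_modGrad_le (hA : D.Assumptions P) {x y : M} (hx : x ∈ D.X) (hy : y ∈ D.X) {b : ℕ}
    {v₀ : TangentSpace 𝓘(ℝ, E) x} (hv₀ : ‖v₀‖ ≤ D.G) (I : Fin b → ι) :
    ‖D.modGrad x v₀ I y‖ ≤ 3 * D.G := by
  rw [modGrad]
  refine (norm_sub_le _ _).trans ?_
  rw [LinearIsometry.norm_map]
  linarith [norm_batchGrad_le hA hy I, norm_batchGrad_le hA hx I, norm_sub_le (D.batchGrad I x) v₀]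

/-- Transport from a point to itself is the identity, so the two mini-batch gradients cancel. The
error at `t = 0` is therefore the error of the snapshot batch alone. -/
theorem modGrad_self (hA : D.Assumptions P) (x : M) {b : ℕ} (v₀ : TangentSpace 𝓘(ℝ, E) x)
    (I : Fin b → ι) : D.modGrad x v₀ I x = v₀ := by
  rw [modGrad, hA.transport_self, sub_sub_cancel]

/-- Mean-square Lipschitz continuity of the component gradients for the vector transport. -/
theorem integral_norm_sq_transport_sub_le [IsProbabilityMeasure P] (hO : D.IsUnbiased P)
    (hA : D.Assumptions P) {x y : M} (hx : x ∈ D.X) (hy : y ∈ D.X) {ξ : TangentSpace 𝓘(ℝ, E) x}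
    (hξ : ‖ξ‖ₑ < D.r) (hxy : D.R x ξ = y) :
    ∫ i, ‖grad (E := E) (D.F i) y - D.T x y (grad (D.F i) x)‖ ^ 2 ∂P
      ≤ ((D.Ll + D.θ * D.G) * ‖ξ‖) ^ 2 := by
  subst hxy
  obtain ⟨hG, -, -, -, hLl, hθ, -, -⟩ := hA.pos
  obtain ⟨Q, hQ, hQint⟩ := hA.average_lipschitz x hx ξ hξ hy
  set A : ι → ℝ := fun i => ‖grad (D.F i) x - Q.symm (grad (D.F i) (D.R x ξ))‖ with hAdef
  set c := D.θ * ‖ξ‖ * D.G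
  set a := D.Ll * ‖ξ‖
  have hc : 0 ≤ c := by positivity
  have ha : 0 ≤ a := by positivity
  -- Insert the parallel transport `Q`: the first difference is the mean-square Lipschitz quantity
  -- `A i`, the second is the transport discrepancy, at most `c` pointwise.
  have hpt : ∀ i, ‖grad (E := E) (D.F i) (D.R x ξ) - D.T x (D.R x ξ) (grad (D.F i) x)‖ ≤ A i + c := by
    intro i
    have h1 : ‖grad (E := E) (D.F i) (D.R x ξ) - Q (grad (D.F i) x)‖ = A i := by
      simp only [hAdef]
      rw [← Q.norm_map (grad (D.F i) x - Q.symm (grad (D.F i) (D.R x ξ))), map_sub,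
        Q.apply_symm_apply, norm_sub_rev]
    have h2 := hA.transport_close x hx ξ hξ hy Q hQ (grad (D.F i) x)
    have h3 : D.θ * ‖ξ‖ * ‖grad (E := E) (D.F i) x‖ ≤ c := by
      exact mul_le_mul_of_nonneg_left (hA.grad_bound x hx i) (by positivity)
    have h4 := norm_sub_le_norm_sub_add_norm_sub (grad (E := E) (D.F i) (D.R x ξ))
      (Q (grad (D.F i) x)) (D.T x (D.R x ξ) (grad (D.F i) x))
    rw [norm_sub_rev (Q _)] at h4
    linarith
  have hAm : MemLp A 2 P :=
    ((hO.memLp_grad hA hx).sub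
      (Q.symm.toContinuousLinearEquiv.toContinuousLinearMap.comp_memLp' (hO.memLp_grad hA hy))).norm
  have hAi := hAm.integrable (by norm_num : (1 : ℝ≥0∞) ≤ 2)
  have hA2 : Integrable (fun i => A i ^ 2) P := hAm.integrable_sq
  -- The variance of `A` is nonnegative, so `(∫ A)² ≤ ∫ A² ≤ a²`. This handles the cross term of `(A
  -- + c)²`.
  have hmean : ∫ i, A i ∂P ≤ a := by
    refine abs_le_of_sq_le_sq' ?_ ha |>.2
    have h0 : 0 ≤ ∫ i, (A i - ∫ j, A j ∂P) ^ 2 ∂P := integral_nonneg fun i => sq_nonneg _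
    have hexp : ∀ i, (A i - ∫ j, A j ∂P) ^ 2
        = A i ^ 2 - 2 * (∫ j, A j ∂P) * A i + (∫ j, A j ∂P) ^ 2 := fun i => by ring
    simp_rw [hexp] at h0
    rw [integral_add (f := fun i => A i ^ 2 - 2 * (∫ j, A j ∂P) * A i) (hA2.sub (hAi.const_mul _))
      (integrable_const _), integral_sub hA2 (hAi.const_mul _), integral_const_mul] at h0
    simp only [integral_const, probReal_univ, one_smul] at h0
    linarith
  have hT2 : Integrable (fun i => ‖grad (E := E) (D.F i) (D.R x ξ)
      - D.T x (D.R x ξ) (grad (D.F i) x)‖ ^ 2) P :=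
    (hO.memLp_transport_sub hA hx hy).integrable_norm_pow (by norm_num)
  have hsq : ∀ i, (A i + c) ^ 2 = A i ^ 2 + 2 * c * A i + c ^ 2 := fun i => by ring
  calc ∫ i, ‖grad (E := E) (D.F i) (D.R x ξ) - D.T x (D.R x ξ) (grad (D.F i) x)‖ ^ 2 ∂P
      ≤ ∫ i, (A i ^ 2 + 2 * c * A i + c ^ 2) ∂P := by
        refine integral_mono hT2 ((hA2.add (hAi.const_mul _)).add (integrable_const _)) fun i => ?_
        rw [← hsq]
        exact pow_le_pow_left₀ (norm_nonneg _) (hpt i) 2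
    _ = ∫ i, A i ^ 2 ∂P + 2 * c * ∫ i, A i ∂P + c ^ 2 := by
        rw [integral_add (f := fun i => A i ^ 2 + 2 * c * A i) (hA2.add (hAi.const_mul _))
          (integrable_const _), integral_add hA2 (hAi.const_mul _), integral_const_mul]
        simp
    _ ≤ a ^ 2 + 2 * c * a + c ^ 2 := by gcongr
    _ = ((D.Ll + D.θ * D.G) * ‖ξ‖) ^ 2 := by simp only [a, c]; ring

/-- Polarization: `2 ⟨g, v⟩ = ‖g‖² + ‖v‖² - ‖v - g‖²` with `g = grad f(x)`, inserted into the
quadratic upper bound along the retraction. -/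
theorem obj_retraction_le (hA : D.Assumptions P) {x : M} (hx : x ∈ D.X)
    {v : TangentSpace 𝓘(ℝ, E) x} {η : ℝ} (hv : ‖-(η • v)‖ₑ < D.r) (hR : D.R x (-(η • v)) ∈ D.X) :
    D.obj P (D.R x (-(η • v))) ≤ D.obj P x - (η / 2 * ‖grad (E := E) (D.obj P) x‖ ^ 2
      + (η / 2 - D.L * η ^ 2 / 2) * ‖v‖ ^ 2 - η / 2 * ‖v - grad (D.obj P) x‖ ^ 2) := by
  have h := hA.retraction_smooth x hx _ hv hR
  rw [norm_neg, norm_smul, mul_pow, Real.norm_eq_abs, sq_abs, inner_neg_right,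
    real_inner_smul_right] at h
  rw [norm_sub_sq_real, real_inner_comm]
  linarith

/-- Conditional second moment of the error of the modified gradient. -/
theorem integral_norm_sq_modGrad_sub_le [IsProbabilityMeasure P] (hO : D.IsUnbiased P)
    (hA : D.Assumptions P) {x y : M} (hx : x ∈ D.X) (hy : y ∈ D.X) (v₀ : TangentSpace 𝓘(ℝ, E) x)
    {b : ℕ} (hb : 0 < b) :
    ∫ I, ‖D.modGrad x v₀ I y - grad (D.obj P) y‖ ^ 2 ∂(Measure.infinitePi fun _ : Fin b => P)
      ≤ (∫ i, ‖grad (E := E) (D.F i) y - D.T x y (grad (D.F i) x)‖ ^ 2 ∂P) / b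
        + ‖v₀ - grad (D.obj P) x‖ ^ 2 := by
  set g : ι → TangentSpace 𝓘(ℝ, E) y := fun i => grad (D.F i) y - D.T x y (grad (D.F i) x) with hg
  have hgm : MemLp g 2 P := hO.memLp_transport_sub hA hx hy
  have hix := (hO.memLp_grad hA hx).integrable (by norm_num : (1 : ℝ≥0∞) ≤ 2)
  have hiy := (hO.memLp_grad hA hy).integrable (by norm_num : (1 : ℝ≥0∞) ≤ 2)
  have hmean : ∫ i, g i ∂P = grad (D.obj P) y - D.T x y (grad (D.obj P) x) := by
    have h1 : ∫ i, D.T x y (grad (D.F i) x) ∂P = D.T x y (grad (D.obj P) x) := by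
      rw [← hO.unbiased x hx]
      exact (D.T x y).toContinuousLinearMap.integral_comp_comm hix
    have h2 : Integrable (fun i => D.T x y (grad (D.F i) x)) P :=
      (D.T x y).toContinuousLinearMap.integrable_comp hix
    simp only [hg]
    rw [integral_sub hiy h2, h1, hO.unbiased y hy]
  have key := integral_norm_sq_iid_average_le (κ := Fin b) P hgm hb (φ := id)
    Function.injective_id (D.T x y (v₀ - grad (D.obj P) x))
  rw [LinearIsometry.norm_map] at key
  have hb' : (0 : ℝ) < b := by exact_mod_cast hb
  have h2 := div_le_div_of_nonneg_right (integral_norm_sub_integral_sq_le hgm) hb'.le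
  refine le_trans (le_of_eq ?_) (key.trans (by linarith))
  refine integral_congr_ae (.of_forall fun I => ?_)
  -- A centred average of the independent vectors `g (I j)`, plus the snapshot error carried to `y`.
  -- The latter does not depend on `I`, and the isometry preserves its norm.
  have : D.modGrad x v₀ I y - grad (D.obj P) y
      = (b : ℝ)⁻¹ • ∑ j, g (I (id j)) - ∫ i, g i ∂P + D.T x y (v₀ - grad (D.obj P) x) := by
    rw [hmean, hg, modGrad, batchGrad, batchGrad]
    simp only [id, Finset.sum_sub_distrib, smul_sub, map_sub, map_smul, map_sum]
    abel
  simp only [this]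

/-- Conditional second moment of the error of the batch gradient, independent draws. -/
theorem integral_norm_sq_batchGrad_sub_le [IsProbabilityMeasure P] (hO : D.IsUnbiased P)
    (hA : D.Assumptions P) {x : M} (hx : x ∈ D.X) {k : ℕ} (hk : 0 < k) :
    ∫ I, ‖D.batchGrad (fun j : Fin k => I j) x - grad (D.obj P) x‖ ^ 2
        ∂(Measure.infinitePi fun _ : ℕ => P) ≤ D.σ ^ 2 / k := by
  have key := integral_norm_sq_iid_average_le (κ := ℕ) P (hO.memLp_grad hA hx) hk
    (φ := fun j : Fin k => (j : ℕ)) Fin.val_injective 0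
  simp only [add_zero, norm_zero, ne_eq, OfNat.ofNat_ne_zero, not_false_eq_true, zero_pow,
    hO.unbiased x hx] at key
  exact key.trans (div_le_div_of_nonneg_right (hA.variance_bound x hx) (by positivity))

/-! ### The recursion: accumulated quantities, call counts and dependence on the draws -/

section Trajectory

variable {E : Type*} [NormedAddCommGroup E] [NormedSpace ℝ E] [FiniteDimensional ℝ E]
  {M : Type*} [EMetricSpace M] [ChartedSpace E M]
  [RiemannianBundle (fun x : M => TangentSpace 𝓘(ℝ, E) x)]
  {ι : Type*} {D : Problem E M ι}
  {η : ℝ} {m : ℕ} {b : ℕ} {B : ℝ → ℕ} {β₁ : ℝ} {ζ ζ' : Draw b → ι} {S : ℕ}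

theorem iterate_succ (s t : ℕ) : D.iterate η m B β₁ ζ s (t + 1)
    = D.R (D.iterate η m B β₁ ζ s t) (-(η • D.direction η m B β₁ ζ s t)) := rfl

theorem iterate_epoch_succ (s : ℕ) :
    D.iterate η m B β₁ ζ (s + 1) 0 = D.iterate η m B β₁ ζ s m := rfl

theorem innerState_β (s : ℕ) (t : ℕ) :
    (D.innerState η m B ζ s (D.epochState η m B β₁ ζ s) t).β
      = (∑ j ∈ Finset.range t, ‖D.direction η m B β₁ ζ s j‖ ^ 2) / m := by
  induction t with
  | zero => simp [innerState]
  | succ t ih =>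
    rw [Finset.sum_range_succ, add_div, ← ih]
    rfl

theorem epochState_succ_β (s : ℕ) : (D.epochState η m B β₁ ζ (s + 1)).β
    = (∑ t ∈ Finset.range m, ‖D.direction η m B β₁ ζ s t‖ ^ 2) / m :=
  innerState_β s m

theorem epochState_β_nonneg (hβ₁ : 0 ≤ β₁) (s : ℕ) : 0 ≤ (D.epochState η m B β₁ ζ s).β := by
  cases s with
  | zero => exact hβ₁
  | succ s => rw [epochState_succ_β]; positivity

theorem innerState_calls (s : ℕ) (st : State M) (t : ℕ) :
    (D.innerState η m B ζ s st t).calls = st.calls + B st.β + 2 * b * t := by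
  induction t with
  | zero => rfl
  | succ t ih =>
    have : (D.innerState η m B ζ s st (t + 1)).calls
      = (D.innerState η m B ζ s st t).calls + 2 * b := rfl
    rw [this, ih]; ring

theorem ifoCalls_eq : D.ifoCalls η m B β₁ ζ S
    = ∑ s ∈ Finset.range S, B (D.epochState η m B β₁ ζ s).β + 2 * b * m * S := by
  induction S with
  | zero => rfl
  | succ s ih =>
    have : D.ifoCalls η m B β₁ ζ (s + 1) = D.ifoCalls η m B β₁ ζ s
        + B (D.epochState η m B β₁ ζ s).β + 2 * b * m := innerState_calls s _ m
    rw [this, ih, Finset.sum_range_succ]; ring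

theorem ifoCalls_eq_avgBatch (hS : 0 < S) : (D.ifoCalls η m B β₁ ζ S : ℝ)
    = S * D.avgBatch η m B β₁ ζ S + 2 * b * m * S := by
  have : (S : ℝ) ≠ 0 := by positivity
  rw [ifoCalls_eq, avgBatch, mul_div_cancel₀ _ this]
  push_cast; rfl

theorem one_le_avgBatch (hS : 0 < S) (hβ₁ : 0 ≤ β₁) (hB : ∀ β, 0 ≤ β → 0 < B β) :
    1 ≤ D.avgBatch η m B β₁ ζ S := by
  have hS' : (0 : ℝ) < S := by exact_mod_cast hS
  rw [avgBatch, one_le_div hS']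
  calc (S : ℝ) = ∑ _s ∈ Finset.range S, (1 : ℝ) := by simp
    _ ≤ _ := Finset.sum_le_sum fun s _ => by
      exact_mod_cast hB _ (epochState_β_nonneg hβ₁ s)

/-! ### Dependence on the draws -/

theorem snapshotGrad_congr (s : ℕ) (st : State M)
    (h : ∀ j < B st.β, ζ (.batch s j) = ζ' (.batch s j)) :
    D.snapshotGrad B ζ s st = D.snapshotGrad B ζ' s st := by
  unfold snapshotGrad
  congr 1
  funext j
  exact h j j.2

theorem innerState_congr (s : ℕ) (st : State M) (t : ℕ)
    (h : ∀ j < B st.β, ζ (.batch s j) = ζ' (.batch s j))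
    (h' : ∀ j < t, ∀ k, ζ (.inner s j k) = ζ' (.inner s j k)) :
    D.innerState η m B ζ s st t = D.innerState η m B ζ' s st t := by
  induction t with
  | zero => rfl
  | succ t ih =>
    rw [innerState, innerState, ih fun j hj => h' j (hj.trans t.lt_succ_self),
      snapshotGrad_congr s st h, funext (h' t t.lt_succ_self)]

/-- Plays the role of adaptedness to a filtration: redrawing indices of epoch `s` or later changes
neither the snapshot point of epoch `s` nor its batch size. -/
theorem epochState_congr (s : ℕ) (h : ∀ l < s, ∀ j, ζ (.batch l j) = ζ' (.batch l j))
    (h' : ∀ l < s, ∀ j < m, ∀ k, ζ (.inner l j k) = ζ' (.inner l j k)) :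
    D.epochState η m B β₁ ζ s = D.epochState η m B β₁ ζ' s := by
  induction s with
  | zero => rfl
  | succ s ih =>
    rw [epochState, epochState, ih (fun l hl => h l (hl.trans s.lt_succ_self))
      (fun l hl => h' l (hl.trans s.lt_succ_self))]
    exact innerState_congr s _ m (fun j _ => h s s.lt_succ_self j) (h' s s.lt_succ_self)

end Trajectory

/-! ### Estimates along trajectories that stay in the neighbourhood -/

section Staying

variable {E : Type*} [NormedAddCommGroup E] [NormedSpace ℝ E] [FiniteDimensional ℝ E]
  {M : Type*} [EMetricSpace M] [ChartedSpace E M] [IsManifold 𝓘(ℝ, E) ∞ M]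
  [RiemannianBundle (fun x : M => TangentSpace 𝓘(ℝ, E) x)]
  {ι : Type*} [MeasurableSpace ι] {D : Problem E M ι} {P : Measure ι}
  {η : ℝ} {m : ℕ} {b : ℕ} {B : ℝ → ℕ} {β₁ : ℝ} {ζ : Draw b → ι} {S : ℕ}

theorem StaysIn.iterate_mem_of_lt (hst : D.StaysIn η m B β₁ ζ S) (hA : D.Assumptions P) {s t : ℕ}
    (hs : s < S) (ht : t < m) : D.iterate η m B β₁ ζ s t ∈ D.X := by
  have := hst s hs t ht 0 ⟨le_rfl, zero_le_one⟩
  rwa [zero_mul, zero_smul, neg_zero, hA.retraction.map_zero] at this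

theorem StaysIn.iterate_mem (hst : D.StaysIn η m B β₁ ζ S) (hA : D.Assumptions P) (hm : 0 < m)
    {s t : ℕ} (hs : s < S) (ht : t ≤ m) : D.iterate η m B β₁ ζ s t ∈ D.X := by
  cases t with
  | zero => exact hst.iterate_mem_of_lt hA hs hm
  | succ t =>
    have := hst s hs t ht 1 ⟨zero_le_one, le_rfl⟩
    rwa [one_mul] at this

theorem StaysIn.enorm_lt (hst : D.StaysIn η m B β₁ ζ S) (hA : D.Assumptions P) {s t : ℕ}
    (hs : s < S) (ht : t < m) : ‖-(η • D.direction η m B β₁ ζ s t)‖ₑ < D.r := by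
  refine hA.totallyRetractive.enorm_lt hA.retraction (hst.iterate_mem_of_lt hA hs ht) fun τ hτ => ?_
  rw [smul_neg, smul_smul]
  exact hst s hs t ht τ hτ

theorem direction_zero (hA : D.Assumptions P) (s : ℕ) : D.direction η m B β₁ ζ s 0
    = D.snapshotGrad B ζ s (D.epochState η m B β₁ ζ s) :=
  modGrad_self hA _ _ _

theorem StaysIn.norm_snapshotGrad_le (hst : D.StaysIn η m B β₁ ζ S) (hA : D.Assumptions P)
    (hm : 0 < m) {s : ℕ} (hs : s < S) :
    ‖D.snapshotGrad B ζ s (D.epochState η m B β₁ ζ s)‖ ≤ D.G :=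
  norm_batchGrad_le hA (hst.iterate_mem_of_lt hA hs hm) _

theorem StaysIn.norm_direction_le (hst : D.StaysIn η m B β₁ ζ S) (hA : D.Assumptions P) {s t : ℕ}
    (hs : s < S) (ht : t < m) : ‖D.direction η m B β₁ ζ s t‖ ≤ 3 * D.G :=
  norm_modGrad_le hA (hst.iterate_mem_of_lt hA hs (Nat.zero_lt_of_lt ht))
    (hst.iterate_mem_of_lt hA hs ht) (hst.norm_snapshotGrad_le hA (Nat.zero_lt_of_lt ht) hs) _

theorem StaysIn.norm_direction_sub_le [IsProbabilityMeasure P] (hst : D.StaysIn η m B β₁ ζ S)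
    (hO : D.IsUnbiased P) (hA : D.Assumptions P) {s t : ℕ} (hs : s < S) (ht : t < m) :
    ‖D.direction η m B β₁ ζ s t - grad (D.obj P) (D.iterate η m B β₁ ζ s t)‖ ≤ 4 * D.G := by
  refine (norm_sub_le _ _).trans ?_
  linarith [hst.norm_direction_le hA hs ht, hO.norm_grad_le hA (hst.iterate_mem_of_lt hA hs ht)]

/-- The triangle inequality along the intermediate iterates. Each step is the retraction of `-η
v_j`, which lies in the ball of radius `r`, so `ν` bounds its Riemannian length. -/
theorem StaysIn.edist_iterate_le (hst : D.StaysIn η m B β₁ ζ S) (hA : D.Assumptions P)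
    {s t : ℕ} (hs : s < S) (ht : t < m) :
    edist (D.iterate η m B β₁ ζ s 0) (D.iterate η m B β₁ ζ s t)
      ≤ ENNReal.ofReal (D.ν * (|η| * ∑ j ∈ Finset.range t, ‖D.direction η m B β₁ ζ s j‖)) := by
  have hν := hA.pos.2.2.2.2.2.2.2
  refine (edist_le_range_sum_edist _ t).trans ?_
  rw [Finset.mul_sum, Finset.mul_sum, ENNReal.ofReal_sum_of_nonneg fun j _ => by positivity]
  refine Finset.sum_le_sum fun j hj => ?_
  have hj' : j < m := (Finset.mem_range.1 hj).trans ht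
  have := (hA.dist_compare _ (hst.iterate_mem_of_lt hA hs hj') _ (hst.enorm_lt hA hs hj')
    (hst.iterate_mem hA (Nat.zero_lt_of_lt ht) hs (t := j + 1) hj')).2
  refine this.trans (le_of_eq ?_)
  rw [ENNReal.ofReal_mul hν.le, enorm_neg, ← ofReal_norm, norm_smul, Real.norm_eq_abs]

/-- Mean-square variation of the component gradients between the snapshot point and the current
iterate. -/
theorem StaysIn.integral_drift_le [IsProbabilityMeasure P] (hst : D.StaysIn η m B β₁ ζ S)
    (hO : D.IsUnbiased P) (hA : D.Assumptions P) {s t : ℕ} (hs : s < S) (ht : t < m) :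
    ∫ i, ‖grad (E := E) (D.F i) (D.iterate η m B β₁ ζ s t)
        - D.T (D.iterate η m B β₁ ζ s 0) (D.iterate η m B β₁ ζ s t)
            (grad (D.F i) (D.iterate η m B β₁ ζ s 0))‖ ^ 2 ∂P
      ≤ (D.Ll + D.θ * D.G) ^ 2 * D.μ ^ 2 * D.ν ^ 2 * η ^ 2
        * (t * ∑ j ∈ Finset.range t, ‖D.direction η m B β₁ ζ s j‖ ^ 2) := by
  have hm := Nat.zero_lt_of_lt ht
  obtain ⟨hG, -, -, -, hLl, hθ, hμ, hν⟩ := hA.pos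
  have hx := hst.iterate_mem_of_lt hA hs hm
  have hy := hst.iterate_mem_of_lt hA hs ht
  -- A single vector `ξ` joins the snapshot point to the current iterate, so no comparison of
  -- transports along the broken path is needed. Its norm is at most `μ` times the distance, hence
  -- `μ ν` times the length of the path of updates.
  obtain ⟨ξ, hξr, hξ⟩ := hA.totallyRetractive.exists_inverse hx hy
  refine (integral_norm_sq_transport_sub_le hO hA hx hy hξr hξ).trans ?_
  have h1 := (hA.dist_compare _ hx ξ hξr (by rw [hξ]; exact hy)).1
  rw [hξ] at h1
  have h2 := h1.trans (mul_le_mul_right (hst.edist_iterate_le hA hs ht) _)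
  set W := ∑ j ∈ Finset.range t, ‖D.direction η m B β₁ ζ s j‖ with hW
  have hW0 : 0 ≤ W := Finset.sum_nonneg fun j _ => norm_nonneg _
  rw [← ENNReal.ofReal_mul hμ.le, ← ofReal_norm,
    ENNReal.ofReal_le_ofReal_iff (by positivity)] at h2
  have hcs : W ^ 2 ≤ t * ∑ j ∈ Finset.range t, ‖D.direction η m B β₁ ζ s j‖ ^ 2 := by
    simpa using sq_sum_le_card_mul_sum_sq (s := Finset.range t)
      (f := fun j => ‖D.direction η m B β₁ ζ s j‖)
  calc ((D.Ll + D.θ * D.G) * ‖ξ‖) ^ 2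
      ≤ ((D.Ll + D.θ * D.G) * (D.μ * (D.ν * (|η| * W)))) ^ 2 := by gcongr
    _ = (D.Ll + D.θ * D.G) ^ 2 * D.μ ^ 2 * D.ν ^ 2 * η ^ 2 * W ^ 2 := by
        simp only [mul_pow, sq_abs]; ring
    _ ≤ _ := by gcongr

/-- The descent inequality summed over all steps of all epochs. -/
theorem StaysIn.sum_descent_le (hst : D.StaysIn η m B β₁ ζ S) (hA : D.Assumptions P)
    (hm : 0 < m) (hS : 0 < S) :
    ∑ s ∈ Finset.range S, ∑ t ∈ Finset.range m,
      (η / 2 * ‖grad (E := E) (D.obj P) (D.iterate η m B β₁ ζ s t)‖ ^ 2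
        + (η / 2 - D.L * η ^ 2 / 2) * ‖D.direction η m B β₁ ζ s t‖ ^ 2
        - η / 2 * ‖D.direction η m B β₁ ζ s t
            - grad (D.obj P) (D.iterate η m B β₁ ζ s t)‖ ^ 2) ≤ D.Δ P := by
  have hepoch : ∀ s < S, ∑ t ∈ Finset.range m,
      (η / 2 * ‖grad (E := E) (D.obj P) (D.iterate η m B β₁ ζ s t)‖ ^ 2
        + (η / 2 - D.L * η ^ 2 / 2) * ‖D.direction η m B β₁ ζ s t‖ ^ 2
        - η / 2 * ‖D.direction η m B β₁ ζ s t
            - grad (D.obj P) (D.iterate η m B β₁ ζ s t)‖ ^ 2)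
      ≤ D.obj P (D.iterate η m B β₁ ζ s 0) - D.obj P (D.iterate η m B β₁ ζ (s + 1) 0) := by
    intro s hs
    rw [iterate_epoch_succ, ← Finset.sum_range_sub' fun t => D.obj P (D.iterate η m B β₁ ζ s t)]
    refine Finset.sum_le_sum fun t ht => ?_
    have ht := Finset.mem_range.1 ht
    have := obj_retraction_le hA (hst.iterate_mem_of_lt hA hs ht) (hst.enorm_lt hA hs ht)
      (hst.iterate_mem hA hm hs (t := t + 1) ht)
    rw [← iterate_succ] at this
    linarith
  refine (Finset.sum_le_sum fun s hs => hepoch s (Finset.mem_range.1 hs)).trans ?_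
  rw [Finset.sum_range_sub' fun s => D.obj P (D.iterate η m B β₁ ζ s 0)]
  obtain ⟨k, rfl⟩ := Nat.exists_eq_succ_of_ne_zero hS.ne'
  have := hA.opt _ (hst.iterate_mem hA hm k.lt_succ_self le_rfl)
  rw [Nat.succ_eq_add_one, iterate_epoch_succ, Δ]
  exact sub_le_sub_left this _

theorem StaysIn.Δ_nonneg (hst : D.StaysIn η m B β₁ ζ S) (hA : D.Assumptions P)
    (hm : 0 < m) (hS : 0 < S) : 0 ≤ D.Δ P :=
  sub_nonneg.2 (hA.opt _ (hst.iterate_mem_of_lt hA hS hm))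

/-- Conditional second moment of the direction error at an inner step. -/
theorem StaysIn.integral_norm_sq_direction_sub_le [IsProbabilityMeasure P]
    (hst : D.StaysIn η m B β₁ ζ S) (hO : D.IsUnbiased P) (hA : D.Assumptions P) (hb : 0 < b)
    {s t : ℕ} (hs : s < S) (ht : t < m) (ζ' : (Fin b → ι) → Draw b → ι)
    (hsame : ∀ I, ∀ d, (∀ k, d ≠ .inner s t k) → ζ' I d = ζ d)
    (hnew : ∀ I k, ζ' I (.inner s t k) = I k) :
    ∫ I, ‖D.direction η m B β₁ (ζ' I) s t - grad (D.obj P) (D.iterate η m B β₁ (ζ' I) s t)‖ ^ 2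
        ∂(Measure.infinitePi fun _ : Fin b => P)
      ≤ ‖D.direction η m B β₁ ζ s 0 - grad (D.obj P) (D.iterate η m B β₁ ζ s 0)‖ ^ 2
        + (D.Ll + D.θ * D.G) ^ 2 * D.μ ^ 2 * D.ν ^ 2 * η ^ 2 / b
          * (t * ∑ j ∈ Finset.range t, ‖D.direction η m B β₁ ζ s j‖ ^ 2) := by
  have hm := Nat.zero_lt_of_lt ht
  have hx := hst.iterate_mem_of_lt hA hs hm
  have hy := hst.iterate_mem_of_lt hA hs ht
  have hbatch : ∀ I l j, ζ' I (.batch l j) = ζ (.batch l j) := fun I l j =>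
    hsame I _ fun k => by simp
  have hinner : ∀ I l j k, l ≠ s ∨ j ≠ t → ζ' I (.inner l j k) = ζ (.inner l j k) :=
    fun I l j k h => hsame I _ fun k' => by
      rw [ne_eq, Draw.inner.injEq]; tauto
  have hdir : ∀ I, ‖D.direction η m B β₁ (ζ' I) s t
      - grad (D.obj P) (D.iterate η m B β₁ (ζ' I) s t)‖
      = ‖D.modGrad (D.iterate η m B β₁ ζ s 0) (D.snapshotGrad B ζ s (D.epochState η m B β₁ ζ s)) I
          (D.iterate η m B β₁ ζ s t) - grad (D.obj P) (D.iterate η m B β₁ ζ s t)‖ := by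
    intro I
    have he : D.epochState η m B β₁ (ζ' I) s = D.epochState η m B β₁ ζ s :=
      epochState_congr s (fun l _ j => hbatch I l j)
        (fun l hl j _ k => hinner I l j k (.inl hl.ne))
    have hi : D.innerState η m B (ζ' I) s (D.epochState η m B β₁ ζ s) t
        = D.innerState η m B ζ s (D.epochState η m B β₁ ζ s) t :=
      innerState_congr s _ t (fun j _ => hbatch I s j)
        (fun j hj k => hinner I s j k (.inr hj.ne))
    have hsn := snapshotGrad_congr (D := D) (B := B) s (D.epochState η m B β₁ ζ s)
      (fun j _ => hbatch I s j)
    -- The tangent spaces vary with the states. As a real-valued function of the states, the norm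
    -- can be rewritten along the equalities `he` and `hi`.
    let N : State M → State M → ℝ := fun st st' =>
      ‖D.modGrad st.x (D.snapshotGrad B (ζ' I) s st) (fun k => ζ' I (.inner s t k)) st'.x
        - grad (D.obj P) st'.x‖
    change N (D.epochState η m B β₁ (ζ' I) s)
      (D.innerState η m B (ζ' I) s (D.epochState η m B β₁ (ζ' I) s) t) = _
    rw [he, hi]
    simp only [N]
    rw [hsn, funext (hnew I)]
    rfl
  simp only [hdir]
  have hb' : (0 : ℝ) < b := by exact_mod_cast hb
  refine (integral_norm_sq_modGrad_sub_le hO hA hx hy _ hb).trans ?_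
  rw [direction_zero hA, add_comm, div_mul_eq_mul_div]
  exact add_le_add le_rfl (div_le_div_of_nonneg_right (hst.integral_drift_le hO hA hs ht) hb'.le)

/-- Agreement on all earlier epochs fixes the snapshot point and the batch size, so the error
depends on `ζ'` only through the batch drawn in epoch `s`. -/
theorem norm_direction_zero_sub_eq (hA : D.Assumptions P) {ζ' : Draw b → ι} (s : ℕ)
    (hbatch : ∀ l < s, ∀ j, ζ' (.batch l j) = ζ (.batch l j))
    (hinner : ∀ l < s, ∀ j < m, ∀ k, ζ' (.inner l j k) = ζ (.inner l j k)) :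
    ‖D.direction η m B β₁ ζ' s 0 - grad (D.obj P) (D.iterate η m B β₁ ζ' s 0)‖
      = ‖D.batchGrad (fun j : Fin (B (D.epochState η m B β₁ ζ s).β) => ζ' (.batch s j))
          (D.iterate η m B β₁ ζ s 0) - grad (D.obj P) (D.iterate η m B β₁ ζ s 0)‖ := by
  have he : D.epochState η m B β₁ ζ' s = D.epochState η m B β₁ ζ s :=
    epochState_congr s hbatch hinner
  rw [direction_zero hA]
  let N : State M → ℝ := fun st => ‖D.snapshotGrad B ζ' s st - grad (D.obj P) st.x‖
  change N (D.epochState η m B β₁ ζ' s) = N (D.epochState η m B β₁ ζ s)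
  rw [he]

end Staying

end Problem

/-! ### Borel measurability of norms and gradients on the tangent bundle -/

section TangentMeasurability

variable {E : Type*} [NormedAddCommGroup E] [NormedSpace ℝ E] [FiniteDimensional ℝ E]
  {M : Type*} [EMetricSpace M] [ChartedSpace E M] [IsManifold 𝓘(ℝ, E) ∞ M]
  [RiemannianBundle (fun x : M => TangentSpace 𝓘(ℝ, E) x)]

omit [FiniteDimensional ℝ E] in
theorem isContinuousRiemannianBundle_tangent
    [h : IsContMDiffRiemannianBundle 𝓘(ℝ, E) ∞ E (fun x : M => TangentSpace 𝓘(ℝ, E) x)] :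
    IsContinuousRiemannianBundle E (fun x : M => TangentSpace 𝓘(ℝ, E) x) := by
  obtain ⟨g, hg, hg'⟩ := h.exists_contMDiff
  exact ⟨g, hg.continuous, hg'⟩

omit [IsManifold 𝓘(ℝ, E) ∞ M] in
theorem inner_grad_left (f : M → ℝ) (x : M) (v : TangentSpace 𝓘(ℝ, E) x) :
    inner ℝ (grad (E := E) f x) v = mfderiv 𝓘(ℝ, E) 𝓘(ℝ, ℝ) f x v :=
  InnerProductSpace.toDual_symm_apply

variable [IsContMDiffRiemannianBundle 𝓘(ℝ, E) ∞ E (fun x : M => TangentSpace 𝓘(ℝ, E) x)]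

omit [FiniteDimensional ℝ E] in
theorem continuous_norm_sq_tangent :
    Continuous fun p : TangentBundle 𝓘(ℝ, E) M => ‖p.2‖ ^ 2 := by
  have := isContinuousRiemannianBundle_tangent (E := E) (M := M)
  simp_rw [← real_inner_self_eq_norm_sq]
  exact Continuous.inner_bundle (F := E) (E := fun x : M => TangentSpace 𝓘(ℝ, E) x)
    (v := fun p : TangentBundle 𝓘(ℝ, E) M => p.2) (w := fun p => p.2) continuous_id continuous_id

-- Pairing with the gradient is the differential, that is, the fibre component of the tangent map of
-- `f`, which is continuous.
omit [IsContMDiffRiemannianBundle 𝓘(ℝ, E) ∞ E (fun x : M => TangentSpace 𝓘(ℝ, E) x)] in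
theorem continuous_inner_grad_tangent {f : M → ℝ} (hf : ContMDiff 𝓘(ℝ, E) 𝓘(ℝ, ℝ) 2 f) :
    Continuous fun p : TangentBundle 𝓘(ℝ, E) M => inner ℝ (grad f p.1) p.2 := by
  simp_rw [inner_grad_left]
  have h1 := hf.continuous_tangentMap (by norm_num)
  have h2 := (tangentBundleModelSpaceHomeomorph 𝓘(ℝ, ℝ)).continuous.comp h1
  exact continuous_snd.comp h2

/-- The norm of the gradient of a `C²` function is lower semicontinuous. -/
theorem lowerSemicontinuous_norm_grad {f : M → ℝ} (hf : ContMDiff 𝓘(ℝ, E) 𝓘(ℝ, ℝ) 2 f) :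
    LowerSemicontinuous fun x => ‖grad (E := E) f x‖ := by
  intro x c hc
  rcases lt_or_ge c 0 with hc0 | hc0
  · exact .of_forall fun y => hc0.trans_le (norm_nonneg _)
  -- Extend `grad f x` to a local field `W`, continuous at `x`. The strict inequality `⟨grad f, W⟩ >
  -- c ‖W‖` holds at `x`, hence nearby, and there Cauchy-Schwarz forces `‖grad f‖ > c`.
  have hext : ContinuousAt (fun y => (⟨y, FiberBundle.extend E (grad (E := E) f x) y⟩ :
      TangentBundle 𝓘(ℝ, E) M)) x :=
    (FiberBundle.mdifferentiableAt_extend (I := 𝓘(ℝ, E)) (F := E)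
      (V := fun x : M => TangentSpace 𝓘(ℝ, E) x) (grad (E := E) f x)).continuousAt
  have h1 := (continuous_inner_grad_tangent hf).continuousAt.comp hext
  have h2 := (continuous_norm_sq_tangent.sqrt).continuousAt.comp hext
  have h3 : ContinuousAt (fun y => inner ℝ (grad (E := E) f y) (FiberBundle.extend E (grad (E := E) f x) y)
      - c * √(‖(FiberBundle.extend E (grad (E := E) f x) y : TangentSpace 𝓘(ℝ, E) y)‖ ^ 2)) x :=
    h1.sub (continuousAt_const.mul h2)
  simp only [Real.sqrt_sq (norm_nonneg _)] at h3
  have hpos : 0 < inner ℝ (grad (E := E) f x) (FiberBundle.extend E (grad (E := E) f x) x)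
      - c * ‖(FiberBundle.extend E (grad (E := E) f x) x : TangentSpace 𝓘(ℝ, E) x)‖ := by
    rw [FiberBundle.extend_apply_self, real_inner_self_eq_norm_sq]
    change c < ‖grad (E := E) f x‖ at hc
    nlinarith
  filter_upwards [h3.eventually (lt_mem_nhds hpos)] with y hy
  have h4 := real_inner_le_norm (grad (E := E) f y) (FiberBundle.extend E (grad (E := E) f x) y)
  by_contra! hcon
  have := mul_le_mul_of_nonneg_right hcon
    (norm_nonneg (FiberBundle.extend E (grad (E := E) f x) y : TangentSpace 𝓘(ℝ, E) y))
  linarith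

omit [FiniteDimensional ℝ E] in
theorem measurable_norm_tangent : Measurable[borel (TangentBundle 𝓘(ℝ, E) M)]
    fun p : TangentBundle 𝓘(ℝ, E) M => ‖p.2‖ := by
  let _ : MeasurableSpace (TangentBundle 𝓘(ℝ, E) M) := borel _
  have : BorelSpace (TangentBundle 𝓘(ℝ, E) M) := ⟨rfl⟩
  simpa [Real.sqrt_sq] using
    (continuous_norm_sq_tangent (E := E) (M := M)).measurable.sqrt

theorem measurable_norm_grad_tangent {f : M → ℝ} (hf : ContMDiff 𝓘(ℝ, E) 𝓘(ℝ, ℝ) 2 f) :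
    Measurable[borel (TangentBundle 𝓘(ℝ, E) M)]
      fun p : TangentBundle 𝓘(ℝ, E) M => ‖grad (E := E) f p.1‖ := by
  let _ : MeasurableSpace (TangentBundle 𝓘(ℝ, E) M) := borel _
  have : BorelSpace (TangentBundle 𝓘(ℝ, E) M) := ⟨rfl⟩
  let _ : MeasurableSpace M := borel M
  have : BorelSpace M := ⟨rfl⟩
  exact (lowerSemicontinuous_norm_grad hf).measurable.comp
    (FiberBundle.continuous_proj E (TangentSpace 𝓘(ℝ, E) : M → Type _)).measurable

/-- Expanding the square leaves only scalar functions, so continuity of the gradient as a section is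
not required. -/
theorem measurable_norm_sub_grad_sq_tangent {f : M → ℝ} (hf : ContMDiff 𝓘(ℝ, E) 𝓘(ℝ, ℝ) 2 f) :
    Measurable[borel (TangentBundle 𝓘(ℝ, E) M)]
      fun p : TangentBundle 𝓘(ℝ, E) M => ‖p.2 - grad f p.1‖ ^ 2 := by
  let _ : MeasurableSpace (TangentBundle 𝓘(ℝ, E) M) := borel _
  have : BorelSpace (TangentBundle 𝓘(ℝ, E) M) := ⟨rfl⟩
  have h : ∀ p : TangentBundle 𝓘(ℝ, E) M, ‖p.2 - grad f p.1‖ ^ 2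
      = ‖p.2‖ ^ 2 - 2 * inner ℝ (grad f p.1) p.2 + ‖grad (E := E) f p.1‖ ^ 2 :=
    fun p => by rw [norm_sub_sq_real, real_inner_comm]
  simp_rw [h]
  exact (continuous_norm_sq_tangent.measurable.sub
    ((continuous_inner_grad_tangent hf).measurable.const_mul 2)).add
    ((measurable_norm_grad_tangent hf).pow_const 2)

section Composition

variable {Ω : Type*} [MeasurableSpace Ω] {x : Ω → M} {v : ∀ w, TangentSpace 𝓘(ℝ, E) (x w)}

omit [FiniteDimensional ℝ E] in
theorem measurable_norm_of_measurable_tangent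
    (h : Measurable[_, borel (TangentBundle 𝓘(ℝ, E) M)]
      fun w => (⟨x w, v w⟩ : TangentBundle 𝓘(ℝ, E) M)) : Measurable fun w => ‖v w‖ :=
  measurable_norm_tangent.comp h

theorem measurable_norm_grad_of_measurable_tangent {f : M → ℝ}
    (hf : ContMDiff 𝓘(ℝ, E) 𝓘(ℝ, ℝ) 2 f)
    (h : Measurable[_, borel (TangentBundle 𝓘(ℝ, E) M)]
      fun w => (⟨x w, v w⟩ : TangentBundle 𝓘(ℝ, E) M)) :
    Measurable fun w => ‖grad (E := E) f (x w)‖ := by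
  have h' := (measurable_norm_grad_tangent hf).comp h
  exact h'

theorem measurable_norm_sub_grad_sq_of_measurable_tangent {f : M → ℝ}
    (hf : ContMDiff 𝓘(ℝ, E) 𝓘(ℝ, ℝ) 2 f)
    (h : Measurable[_, borel (TangentBundle 𝓘(ℝ, E) M)]
      fun w => (⟨x w, v w⟩ : TangentBundle 𝓘(ℝ, E) M)) :
    Measurable fun w => ‖v w - grad f (x w)‖ ^ 2 := by
  have h' := (measurable_norm_sub_grad_sq_tangent hf).comp h
  exact h'

end Composition

end TangentMeasurability

namespace Problem

/-! ### Oracle counts in terms of the problem constants, and the output norm -/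

section Counts

variable {E : Type*} [NormedAddCommGroup E] [NormedSpace ℝ E] [FiniteDimensional ℝ E]
  {M : Type*} [EMetricSpace M] [ChartedSpace E M]
  [RiemannianBundle (fun x : M => TangentSpace 𝓘(ℝ, E) x)]
  {ι : Type*} {D : Problem E M ι}
  {η : ℝ} {m : ℕ} {b : ℕ} {B : ℝ → ℕ} {β₁ : ℝ} {ζ : Draw b → ι} {S : ℕ}

omit [FiniteDimensional ℝ E] in
theorem η_eq : D.η = 3 / (2 * D.Θ 3) := by
  rw [η, Θ]; congr 1; ring

omit [FiniteDimensional ℝ E] in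
theorem Θ_pos (hL : 0 < D.L) (ϱ : ℝ) : 0 < D.Θ ϱ :=
  add_pos_of_pos_of_nonneg hL (Real.sqrt_nonneg _)

omit [FiniteDimensional ℝ E] in
theorem η_pos (hL : 0 < D.L) : 0 < D.η := by
  rw [η_eq]; have := D.Θ_pos hL 3; positivity

-- With `η = 3 / (2 Θ)` the reciprocal of the step size becomes a multiple of `Θ`; this is what
-- fixes `ϱ = 3`.
omit [FiniteDimensional ℝ E] in
theorem epochs_ratio_eq (hL : 0 < D.L) {Δ ε : ℝ} :
    4 * Δ / (ε ^ 2 * m * D.η) = 8 / 3 * (Δ * D.Θ 3 / ε ^ 2 / m) := by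
  have := D.Θ_pos hL 3
  rw [η_eq]
  field_simp
  ring

/-- Oracle calls in the finite-sum setting. -/
theorem ifoCalls_le_finite {n : ℕ} [NeZero n] (hL : 0 < D.L) {Δ ε : ℝ} (hΔ : 0 ≤ Δ) (hε : 0 < ε)
    (hβ₁ : 0 ≤ β₁) (hB : ∀ β, 0 ≤ β → 0 < B β) (hm : m = ⌊(n : ℝ) ^ (1 / 3 : ℝ)⌋₊)
    {ζ : Draw (m ^ 2) → ι} (hS : S = numEpochs Δ ε D.η m) :
    (ε ^ 2 * m * D.η ≤ 4 * Δ → (D.ifoCalls D.η m B β₁ ζ S : ℝ) ≤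
      48 * (D.avgBatch D.η m B β₁ ζ S
        + Δ * D.Θ 3 * D.avgBatch D.η m B β₁ ζ S / ((n : ℝ) ^ (1 / 3 : ℝ) * ε ^ 2)
        + Δ * D.Θ 3 * (n : ℝ) ^ (2 / 3 : ℝ) / ε ^ 2)) ∧
    (D.ifoCalls D.η m B β₁ ζ S : ℝ) ≤
      48 * (n + D.avgBatch D.η m B β₁ ζ S
        + Δ * D.Θ 3 * D.avgBatch D.η m B β₁ ζ S / ((n : ℝ) ^ (1 / 3 : ℝ) * ε ^ 2)
        + Δ * D.Θ 3 * (n : ℝ) ^ (2 / 3 : ℝ) / ε ^ 2) := by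
  have hn : (1 : ℝ) ≤ n := by exact_mod_cast NeZero.one_le
  have hn0 : (0 : ℝ) ≤ n := by linarith
  set p := (n : ℝ) ^ (1 / 3 : ℝ) with hp
  have hp1 : 1 ≤ p := Real.one_le_rpow hn (by norm_num)
  have hm1 : 1 ≤ m := by rw [hm]; exact Nat.le_floor (by simpa using hp1)
  have hm1' : (1 : ℝ) ≤ m := by exact_mod_cast hm1
  have hmp : (m : ℝ) ≤ p := by rw [hm]; exact Nat.floor_le (by linarith)
  have hpm : p ≤ 2 * m := by
    have : p < m + 1 := by rw [hm]; exact Nat.lt_floor_add_one p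
    linarith
  have hp3 : (n : ℝ) = p ^ 3 := by
    rw [hp, ← Real.rpow_natCast, ← Real.rpow_mul hn0]; norm_num
  have hp2 : (n : ℝ) ^ (2 / 3 : ℝ) = p ^ 2 := by
    rw [hp, ← Real.rpow_natCast, ← Real.rpow_mul hn0]; norm_num
  have hpos : 0 < ε ^ 2 * m * D.η := by have := D.η_pos hL; positivity
  have hS0 : 0 < S := hS ▸ numEpochs_pos _ _ _ _
  have hΘ := D.Θ_pos hL 3
  rw [ifoCalls_eq_avgBatch hS0, hp2]
  have hB1 := one_le_avgBatch (D := D) (η := D.η) (m := m) (ζ := ζ) hS0 hβ₁ hB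
  set Bt := D.avgBatch D.η m B β₁ ζ S
  obtain ⟨h1, h2⟩ := calls_bound_finite (S := S) (A := Δ * D.Θ 3 / ε ^ 2) (B := Bt)
    (by linarith : (0 : ℝ) < m) hmp hpm (by positivity) (by linarith)
  have e1 : (S : ℝ) * Bt + 2 * ((m ^ 2 : ℕ) : ℝ) * m * S = S * Bt + 2 * (m : ℝ) ^ 3 * S := by
    push_cast; ring
  have e2 : Δ * D.Θ 3 / ε ^ 2 * Bt / p = Δ * D.Θ 3 * Bt / (p * ε ^ 2) := by field_simp
  have e3 : Δ * D.Θ 3 / ε ^ 2 * p ^ 2 = Δ * D.Θ 3 * p ^ 2 / ε ^ 2 := by ring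
  rw [e2, e3] at h1 h2
  rw [e1, hp3]
  refine ⟨fun hle => h1 ?_, h2 ?_⟩
  · have := numEpochs_le_two_mul hΔ hpos hle
    rw [← hS, D.epochs_ratio_eq hL] at this
    linarith
  · have := numEpochs_le hΔ hpos
    rwa [← hS, D.epochs_ratio_eq hL] at this

/-- Oracle calls in the online setting. -/
theorem ifoCalls_le_online {σ : ℝ} (hσ : 0 < σ) (hL : 0 < D.L) {Δ ε : ℝ} (hΔ : 0 ≤ Δ) (hε : 0 < ε)
    (hβ₁ : 0 ≤ β₁) (hB : ∀ β, 0 ≤ β → 0 < B β) (hm : m = ⌈(σ / ε) ^ (2 / 3 : ℝ)⌉₊)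
    {ζ : Draw (m ^ 2) → ι} (hS : S = numEpochs Δ ε D.η m) :
    (ε ^ 2 * m * D.η ≤ 4 * Δ → (D.ifoCalls D.η m B β₁ ζ S : ℝ) ≤
      48 * (Δ * D.Θ 3 * D.avgBatch D.η m B β₁ ζ S / (σ ^ (2 / 3 : ℝ) * ε ^ (4 / 3 : ℝ))
        + Δ * D.Θ 3 * σ ^ (4 / 3 : ℝ) / ε ^ (10 / 3 : ℝ))) ∧
    (D.ifoCalls D.η m B β₁ ζ S : ℝ) ≤
      48 * (σ ^ 2 / ε ^ 2 + D.avgBatch D.η m B β₁ ζ S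
        + Δ * D.Θ 3 * D.avgBatch D.η m B β₁ ζ S / (σ ^ (2 / 3 : ℝ) * ε ^ (4 / 3 : ℝ))
        + Δ * D.Θ 3 * σ ^ (4 / 3 : ℝ) / ε ^ (10 / 3 : ℝ)) := by
  have hq : 0 < σ / ε := by positivity
  set p := (σ / ε) ^ (2 / 3 : ℝ) with hp
  have hp0 : 0 < p := by positivity
  have hpm : p ≤ m := by rw [hm]; exact Nat.le_ceil p
  have hmp : (m : ℝ) = 1 ∨ (m : ℝ) ≤ 2 * p := by
    rcases le_total p 1 with h | h
    · left
      have h1 : m ≤ 1 := by rw [hm]; exact Nat.ceil_le.2 (by simpa using h)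
      have h2 : 0 < m := by rw [hm]; exact Nat.ceil_pos.2 hp0
      exact_mod_cast le_antisymm h1 h2
    · right
      have : (m : ℝ) < p + 1 := by rw [hm]; exact Nat.ceil_lt_add_one hp0.le
      linarith
  have hp3 : σ ^ 2 / ε ^ 2 = p ^ 3 := by
    rw [hp, ← Real.rpow_natCast _ 3, ← Real.rpow_mul hq.le, ← div_pow]; norm_num
  have hσ23 : σ ^ (2 / 3 : ℝ) * ε ^ (4 / 3 : ℝ) = p * ε ^ 2 := by
    rw [hp, Real.div_rpow hσ.le hε.le, div_mul_eq_mul_div, eq_div_iff (by positivity), mul_assoc,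
      ← Real.rpow_add hε, ← Real.rpow_natCast ε 2]
    norm_num
  have hσ43 : σ ^ (4 / 3 : ℝ) / ε ^ (10 / 3 : ℝ) = p ^ 2 / ε ^ 2 := by
    rw [hp, ← Real.rpow_natCast _ 2, ← Real.rpow_mul hq.le, Real.div_rpow hσ.le hε.le, div_div,
      ← Real.rpow_natCast ε 2, ← Real.rpow_add hε]
    norm_num
  have hm0 : (0 : ℝ) < m := hp0.trans_le hpm
  have hpos : 0 < ε ^ 2 * m * D.η := by have := D.η_pos hL; positivity
  have hS0 : 0 < S := hS ▸ numEpochs_pos _ _ _ _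
  have hΘ := D.Θ_pos hL 3
  rw [ifoCalls_eq_avgBatch hS0, hσ23, mul_div_assoc _ (σ ^ (4 / 3 : ℝ)), hσ43]
  have hB1 := one_le_avgBatch (D := D) (η := D.η) (m := m) (ζ := ζ) hS0 hβ₁ hB
  set Bt := D.avgBatch D.η m B β₁ ζ S
  obtain ⟨h1, h2⟩ := calls_bound_online (S := S) (A := Δ * D.Θ 3 / ε ^ 2) (B := Bt)
    hp0 hpm hmp (by positivity) hB1
  have e1 : (S : ℝ) * Bt + 2 * ((m ^ 2 : ℕ) : ℝ) * m * S = S * Bt + 2 * (m : ℝ) ^ 3 * S := by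
    push_cast; ring
  have e2 : Δ * D.Θ 3 / ε ^ 2 * Bt / p = Δ * D.Θ 3 * Bt / (p * ε ^ 2) := by field_simp
  have e3 : Δ * D.Θ 3 / ε ^ 2 * p ^ 2 = Δ * D.Θ 3 * (p ^ 2 / ε ^ 2) := by ring
  rw [e2, e3] at h1 h2
  rw [e1, hp3]
  refine ⟨fun hle => h1 ?_, h2 ?_⟩
  · have := numEpochs_le_two_mul hΔ hpos hle
    rw [← hS, D.epochs_ratio_eq hL] at this
    linarith
  · have := numEpochs_le hΔ hpos
    rwa [← hS, D.epochs_ratio_eq hL] at this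

/-- The output gradient norm is controlled by the mean of the squared gradient norms. -/
theorem outputGradNorm_le [MeasurableSpace ι] (P : Measure ι) {ε : ℝ} (hε : 0 < ε) (hm : 0 < m)
    (hS : 0 < S) : D.outputGradNorm η m B β₁ ζ P S ≤
      ((∑ s ∈ Finset.range S, ∑ t ∈ Finset.range m,
        ‖grad (E := E) (D.obj P) (D.iterate η m B β₁ ζ s t)‖ ^ 2) + S * m * ε ^ 2)
        / (2 * ε * (S * m)) := by
  have hSm : (0 : ℝ) < S * m := by positivity
  -- AM-GM instead of Jensen: the bound is affine in `x²`, so it can be averaged over steps, epochs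
  -- and draws alike.
  have hpt : ∀ x : ℝ, x ≤ (x ^ 2 + ε ^ 2) / (2 * ε) := fun x => by
    rw [le_div_iff₀ (by positivity)]; nlinarith [sq_nonneg (x - ε)]
  rw [outputGradNorm, ← div_div _ (2 * ε)]
  refine div_le_div_of_nonneg_right ?_ hSm.le
  calc _ ≤ ∑ s ∈ Finset.range S, ∑ t ∈ Finset.range m,
        (‖grad (E := E) (D.obj P) (D.iterate η m B β₁ ζ s t)‖ ^ 2 + ε ^ 2) / (2 * ε) :=
        Finset.sum_le_sum fun s _ => Finset.sum_le_sum fun t _ => hpt _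
    _ = _ := by
        simp only [← Finset.sum_div, Finset.sum_add_distrib, Finset.sum_const, Finset.card_range,
          nsmul_eq_mul]
        ring

theorem average_bound {A ε S m : ℝ} (hε : 0 < ε) (hm : 0 < m) (hS : 0 < S)
    (h : A ≤ S * m * ε ^ 2) : (A + S * m * ε ^ 2) / (2 * ε * (S * m)) ≤ ε := by
  rw [div_le_iff₀ (by positivity)]
  nlinarith

theorem η_condition [MeasurableSpace ι] [IsManifold 𝓘(ℝ, E) ∞ M] {P : Measure ι}
    (hA : D.Assumptions P) : 0 ≤ 3 / 4 - D.L * D.η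
      - (D.Ll + D.θ * D.G) ^ 2 * D.μ ^ 2 * D.ν ^ 2 * D.η ^ 2 / 2 :=
  stepSize_condition hA.pos.2.2.2.1 (by positivity) (by rw [η]; simp only [mul_assoc])

end Counts

/-! ### Unbiasedness in the finite-sum setting -/

section FiniteSum

variable {E : Type*} [NormedAddCommGroup E] [NormedSpace ℝ E] [FiniteDimensional ℝ E]
  {M : Type*} [EMetricSpace M] [ChartedSpace E M] [IsManifold 𝓘(ℝ, E) ∞ M]
  [RiemannianBundle (fun x : M => TangentSpace 𝓘(ℝ, E) x)]
  {n : ℕ} [NeZero n] {D : Problem E M (Fin n)}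

instance isProbabilityMeasure_unif : IsProbabilityMeasure (unif n) :=
  PMF.toMeasure.isProbabilityMeasure _

theorem integral_unif {V : Type*} [NormedAddCommGroup V] [NormedSpace ℝ V] [CompleteSpace V]
    (f : Fin n → V) : ∫ i, f i ∂(unif n) = (n : ℝ)⁻¹ • ∑ i, f i := by
  rw [unif, integral_uniformOfFintype, Fintype.card_fin]

/-- The differential is linear over the finite average, so in the finite-sum setting unbiasedness is
proved, not assumed. -/
theorem grad_obj_unif (hA : D.Assumptions (unif n)) (x : M) :
    grad (E := E) (D.obj (unif n)) x = (n : ℝ)⁻¹ • ∑ i, grad (E := E) (D.F i) x := by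
  have hobj : D.obj (unif n) = (n : ℝ)⁻¹ • ∑ i, D.F i := by
    funext y
    rw [obj, integral_unif]
    simp
  let A : Fin n → TangentSpace 𝓘(ℝ, E) x →L[ℝ] ℝ := fun i =>
    mfderiv 𝓘(ℝ, E) 𝓘(ℝ, ℝ) (D.F i) x
  have hd : HasMFDerivAt 𝓘(ℝ, E) 𝓘(ℝ, ℝ) (D.obj (unif n)) x ((n : ℝ)⁻¹ • ∑ i, A i) := by
    rw [hobj]
    refine HasMFDerivAt.const_smul (HasMFDerivAt.sum fun i _ => ?_) _
    exact ((hA.smooth_component i).mdifferentiable (by norm_num) x).hasMFDerivAt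
  have hg : ∀ i, grad (E := E) (D.F i) x
      = (InnerProductSpace.toDual ℝ (TangentSpace 𝓘(ℝ, E) x)).symm (A i) := fun i => rfl
  have hg' : grad (E := E) (D.obj (unif n)) x
      = (InnerProductSpace.toDual ℝ (TangentSpace 𝓘(ℝ, E) x)).symm ((n : ℝ)⁻¹ • ∑ i, A i) := by
    rw [← hd.mfderiv]; rfl
  simp only [hg, hg']
  rw [map_smulₛₗ, map_sum]
  simp

theorem isUnbiased_unif (hA : D.Assumptions (unif n)) : D.IsUnbiased (unif n) where
  measurable_grad _ _ := AEStronglyMeasurable.of_discrete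
  unbiased x _ := by rw [grad_obj_unif hA, integral_unif]

end FiniteSum

end Problem

/-! ### Resampling one mini-batch or one permutation -/

section Draws

variable {n S m b : ℕ} [NeZero n]

/-- Replace the mini-batch of step `t` of epoch `s`. -/
def FiniteSumSample.setInner (s : Fin S) (t : Fin m) (ζ : FiniteSumSample n S m b)
    (I : Fin b → Fin n) : FiniteSumSample n S m b :=
  (ζ.1, Function.update ζ.2 s (Function.update (ζ.2 s) t I))

/-- Replace the permutation of epoch `s`. -/
def FiniteSumSample.setBatch (s : Fin S) (ζ : FiniteSumSample n S m b) (e : Equiv.Perm (Fin n)) :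
    FiniteSumSample n S m b :=
  (Function.update ζ.1 s e, ζ.2)

theorem FiniteSumSample.draws_setInner_same (s : Fin S) (t : Fin m) (ζ : FiniteSumSample n S m b)
    (I : Fin b → Fin n) (k : Fin b) : (setInner s t ζ I).draws (.inner s t k) = I k := by
  simp [draws, setInner]

theorem FiniteSumSample.draws_setInner_of_ne (s : Fin S) (t : Fin m) (ζ : FiniteSumSample n S m b)
    (I : Fin b → Fin n) (d : Draw b) (hd : ∀ k, d ≠ .inner s t k) :
    (setInner s t ζ I).draws d = ζ.draws d := by
  cases d with
  | batch s' j => simp [draws, setInner]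
  | inner s' t' k =>
    simp only [draws, setInner]
    split_ifs with h
    · by_cases hs : (⟨s', h.1⟩ : Fin S) = s
      · have ht : (⟨t', h.2⟩ : Fin m) ≠ t := by
          rintro rfl
          subst hs
          exact hd k rfl
        subst hs
        rw [Function.update_self, Function.update_of_ne ht]
      · rw [Function.update_of_ne hs]
    · rfl

theorem FiniteSumSample.draws_setBatch_same (s : Fin S) (ζ : FiniteSumSample n S m b)
    (e : Equiv.Perm (Fin n)) (j : ℕ) : (setBatch s ζ e).draws (.batch s j) = e (Fin.ofNat n j) := by
  simp [draws, setBatch]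

theorem FiniteSumSample.draws_setBatch_batch_of_ne (s : Fin S) (ζ : FiniteSumSample n S m b)
    (e : Equiv.Perm (Fin n)) {l : ℕ} (hl : l ≠ s) (j : ℕ) :
    (setBatch s ζ e).draws (.batch l j) = ζ.draws (.batch l j) := by
  simp only [draws, setBatch]
  split_ifs with h
  · rw [Function.update_of_ne]
    rintro rfl
    exact hl rfl
  · rfl

theorem FiniteSumSample.expect_setInner (s : Fin S) (t : Fin m) (h : FiniteSumSample n S m b → ℝ) :
    Finset.expect Finset.univ (fun ζ => Finset.expect Finset.univ fun I => h (setInner s t ζ I))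
      = Finset.expect Finset.univ h :=
  expect_resample (setInner s t) (fun ζ => ζ.2 s t) (fun ζ I => by simp [setInner])
    (fun ζ I => by simp [setInner]) h

omit [NeZero n] in
theorem FiniteSumSample.expect_setBatch (s : Fin S) (h : FiniteSumSample n S m b → ℝ) :
    Finset.expect Finset.univ (fun ζ => Finset.expect Finset.univ fun e => h (setBatch s ζ e))
      = Finset.expect Finset.univ h :=
  expect_resample (setBatch s) (fun ζ => ζ.1 s) (fun ζ e => by simp [setBatch])
    (fun ζ e => by simp [setBatch]) h

end Draws

namespace Problem

/-! ### Expected gradient norm, finite-sum setting -/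

section FiniteSum

variable {E : Type*} [NormedAddCommGroup E] [NormedSpace ℝ E] [FiniteDimensional ℝ E]
  {M : Type*} [EMetricSpace M] [ChartedSpace E M] [IsManifold 𝓘(ℝ, E) ∞ M]
  [RiemannianBundle (fun x : M => TangentSpace 𝓘(ℝ, E) x)]
  {n : ℕ} [NeZero n] {D : Problem E M (Fin n)}

/-- Second moment of the error of the batch gradient for sampling without replacement. -/
theorem expect_norm_sq_batchGrad_sub_le (hA : D.Assumptions (unif n)) {x : M} (hx : x ∈ D.X)
    {k : ℕ} (hk : 0 < k) (hkn : k ≤ n) {τ : ℝ} (hτ : 0 ≤ τ) (h : k < n → D.σ ^ 2 / k ≤ τ) :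
    Finset.expect Finset.univ (fun e : Equiv.Perm (Fin n) =>
      ‖D.batchGrad (fun j : Fin k => e (Fin.ofNat n j)) x - grad (D.obj (unif n)) x‖ ^ 2) ≤ τ := by
  set g : Fin n → TangentSpace 𝓘(ℝ, E) x := fun i => grad (D.F i) x - grad (D.obj (unif n)) x with hg
  have h0 : ∑ i, g i = 0 := by
    have hn : (n : ℝ) ≠ 0 := by exact_mod_cast NeZero.ne n
    rw [hg, Finset.sum_sub_distrib, grad_obj_unif hA, Finset.sum_const, Finset.card_univ,
      Fintype.card_fin, ← Nat.cast_smul_eq_nsmul ℝ, smul_smul, mul_inv_cancel₀ hn, one_smul, sub_self]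
  have hb : ∀ e : Equiv.Perm (Fin n),
      D.batchGrad (fun j : Fin k => e (Fin.ofNat n j)) x - grad (D.obj (unif n)) x
        = (k : ℝ)⁻¹ • ∑ j : Fin k, g (e (Fin.ofNat n j)) := fun e =>
    (inv_smul_sum_sub_const hk _ _).symm
  simp only [hb]
  -- A proper sample obeys the without-replacement bound. For `k = n` the permutation runs through
  -- all components and the centred sum is zero, so `0 ≤ τ` suffices.
  rcases hkn.lt_or_eq with hlt | rfl
  · have hφ : Function.Injective fun j : Fin k => Fin.ofNat n (j : ℕ) := fun i j hij => by
      have := congrArg Fin.val hij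
      simp only [Fin.ofNat, Nat.mod_eq_of_lt (i.2.trans hlt), Nat.mod_eq_of_lt (j.2.trans hlt)] at this
      exact Fin.ext this
    refine (expect_norm_sq_perm_average_le h0 hφ).trans (le_trans ?_ (h hlt))
    refine div_le_div_of_nonneg_right ?_ (by positivity)
    have := hA.variance_bound x hx
    rwa [unif, integral_uniformOfFintype_real] at this
  · have hz : ∀ e : Equiv.Perm (Fin k), ∑ j : Fin k, g (e (Fin.ofNat k j)) = 0 := fun e => by
      have : ∀ j : Fin k, Fin.ofNat k (j : ℕ) = j := fun j => by simp
      simp only [this]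
      rw [Equiv.sum_comp, h0]
    simp only [hz]
    simpa using hτ

theorem expect_outputGradNorm_le (hA : D.Assumptions (unif n)) {ε α₁ β₁ : ℝ} {m S : ℕ}
    (hε : 0 < ε) (hα₁ : 4 ≤ α₁) (hm : 0 < m) (hS : S = numEpochs (D.Δ (unif n)) ε D.η m)
    (hβ₁ : 0 ≤ β₁) (hβ₁' : β₁ ≤ ε ^ 2 * S)
    (hst : ∀ ζ : FiniteSumSample n S m (m ^ 2),
      D.StaysIn D.η m (finiteSumBatchSize α₁ D.σ n) β₁ ζ.draws S) :
    Finset.expect Finset.univ (fun ζ : FiniteSumSample n S m (m ^ 2) =>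
      D.outputGradNorm D.η m (finiteSumBatchSize α₁ D.σ n) β₁ ζ.draws (unif n) S) ≤ ε := by
  have hO := isUnbiased_unif hA
  set B := finiteSumBatchSize α₁ D.σ n with hB
  have hL : 0 < D.L := hA.pos.2.2.2.1
  have hσ : 0 < D.σ := hA.pos.2.2.1
  have hη := D.η_pos hL
  have hm' : (0 : ℝ) < m := by exact_mod_cast hm
  have hS0 : 0 < S := hS ▸ numEpochs_pos _ _ _ _
  have hS0' : (0 : ℝ) < S := by exact_mod_cast hS0
  have hb : 0 < m ^ 2 := pow_pos hm 2
  have hSm : 4 * D.Δ (unif n) ≤ S * (ε ^ 2 * m * D.η) := hS ▸ le_numEpochs_mul (by positivity)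
  let Ω := FiniteSumSample n S m (m ^ 2)
  let A : Ω → ℕ → ℕ → ℝ := fun ζ s t =>
    ‖grad (E := E) (D.obj (unif n)) (D.iterate D.η m B β₁ ζ.draws s t)‖ ^ 2
  let V : Ω → ℕ → ℕ → ℝ := fun ζ s t => ‖D.direction D.η m B β₁ ζ.draws s t‖ ^ 2
  let e : Ω → ℕ → ℕ → ℝ := fun ζ s t => ‖D.direction D.η m B β₁ ζ.draws s t
    - grad (D.obj (unif n)) (D.iterate D.η m B β₁ ζ.draws s t)‖ ^ 2
  let β : Ω → ℕ → ℝ := fun ζ s => (D.epochState D.η m B β₁ ζ.draws s).β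
  have key := sum_sq_grad_le (S := S) (m := m) (η := D.η) (L := D.L) (ε := ε) (Δ := D.Δ (unif n))
    (κ := (D.Ll + D.θ * D.G) ^ 2 * D.μ ^ 2 * D.ν ^ 2)
    (a := fun s t => Finset.expect Finset.univ fun ζ => A ζ s t)
    (V := fun s t => Finset.expect Finset.univ fun ζ => V ζ s t)
    (e := fun s t => Finset.expect Finset.univ fun ζ => e ζ s t)
    (β := fun s => Finset.expect Finset.univ fun ζ => β ζ s)
    hm hη (by positivity) (fun s t => Finset.expect_nonneg fun ζ _ => sq_nonneg _)
    (η_condition hA) ?_ ?_ ?_ ?_ ?_ hSm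
  · calc Finset.expect Finset.univ (fun ζ : Ω => D.outputGradNorm D.η m B β₁ ζ.draws (unif n) S)
        ≤ Finset.expect Finset.univ (fun ζ : Ω =>
            ((∑ s ∈ Finset.range S, ∑ t ∈ Finset.range m, A ζ s t) + S * m * ε ^ 2)
              / (2 * ε * (S * m))) :=
          Finset.expect_le_expect fun ζ _ => outputGradNorm_le _ hε hm hS0
      _ = ((∑ s ∈ Finset.range S, ∑ t ∈ Finset.range m,
            Finset.expect Finset.univ fun ζ => A ζ s t) + S * m * ε ^ 2) / (2 * ε * (S * m)) := by
          rw [← Finset.expect_div, Finset.expect_add_distrib, Fintype.expect_const,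
            Finset.expect_sum_comm]
          simp only [Finset.expect_sum_comm]
      _ ≤ ε := average_bound hε hm' hS0' key
  · calc _ = Finset.expect Finset.univ (fun ζ : Ω => ∑ s ∈ Finset.range S, ∑ t ∈ Finset.range m,
          (D.η / 2 * A ζ s t + (D.η / 2 - D.L * D.η ^ 2 / 2) * V ζ s t - D.η / 2 * e ζ s t)) := by
          simp only [Finset.expect_sum_comm, Finset.expect_add_distrib, Finset.expect_sub_distrib,
            Finset.mul_expect]
      _ ≤ Finset.expect Finset.univ (fun _ : Ω => D.Δ (unif n)) :=
          Finset.expect_le_expect fun ζ _ => (hst ζ).sum_descent_le hA hm hS0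
      _ = _ := Fintype.expect_const _
  · intro s hs t ht
    -- Redraw only the mini-batch of this step: the past of the trajectory is fixed in the inner
    -- average, where the conditional bound applies with `b = m²`.
    rw [← FiniteSumSample.expect_setInner ⟨s, hs⟩ ⟨t, ht⟩]
    calc _ ≤ Finset.expect Finset.univ (fun ζ : Ω => e ζ s 0
          + (D.Ll + D.θ * D.G) ^ 2 * D.μ ^ 2 * D.ν ^ 2 * D.η ^ 2 / (m : ℝ) ^ 2
            * (t * ∑ j ∈ Finset.range t, V ζ s j)) := by
          refine Finset.expect_le_expect fun ζ _ => ?_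
          have := (hst ζ).integral_norm_sq_direction_sub_le hO hA hb hs ht
            (fun I => (FiniteSumSample.setInner ⟨s, hs⟩ ⟨t, ht⟩ ζ I).draws)
            (fun I d hd => FiniteSumSample.draws_setInner_of_ne ⟨s, hs⟩ ⟨t, ht⟩ ζ I d hd)
            (fun I k => FiniteSumSample.draws_setInner_same ⟨s, hs⟩ ⟨t, ht⟩ ζ I k)
          rw [integral_infinitePi_unif, Nat.cast_pow] at this
          exact this
      _ = _ := by
          simp only [Finset.expect_add_distrib, ← Finset.mul_expect, Finset.expect_sum_comm]
  · intro s hs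
    rw [← FiniteSumSample.expect_setBatch ⟨s, hs⟩]
    calc _ ≤ Finset.expect Finset.univ (fun ζ : Ω => β ζ s / 4) := by
          refine Finset.expect_le_expect fun ζ _ => ?_
          have hβ0 : 0 ≤ β ζ s := epochState_β_nonneg hβ₁ s
          have heq : ∀ e' : Equiv.Perm (Fin n), e (FiniteSumSample.setBatch ⟨s, hs⟩ ζ e') s 0
              = ‖D.batchGrad (fun j : Fin (B (β ζ s)) => e' (Fin.ofNat n j))
                  (D.iterate D.η m B β₁ ζ.draws s 0)
                - grad (D.obj (unif n)) (D.iterate D.η m B β₁ ζ.draws s 0)‖ ^ 2 := fun e' => by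
            simp only [e]
            rw [norm_direction_zero_sub_eq hA (ζ := ζ.draws) s
              (fun l hl j => FiniteSumSample.draws_setBatch_batch_of_ne ⟨s, hs⟩ ζ e' hl.ne j)
              (fun l _ j _ k => rfl)]
            simp only [FiniteSumSample.draws_setBatch_same ⟨s, hs⟩ ζ e']
            rfl
          simp only [heq]
          exact expect_norm_sq_batchGrad_sub_le hA ((hst ζ).iterate_mem_of_lt hA hs hm)
            (finiteSumBatchSize_pos hα₁ hσ hβ0) (finiteSumBatchSize_le _ _ _ _) (by positivity)
            (sq_div_finiteSumBatchSize_le hα₁ hσ hβ0)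
      -- Here `β / 4` alone bounds the batch error; the summand `ε² / 4` serves the online setting.
      _ ≤ _ := by
          rw [← Finset.expect_div]
          have := sq_nonneg ε
          linarith
  · intro s _
    rw [← Finset.expect_sum_comm, Finset.expect_div]
    exact Finset.expect_congr rfl fun ζ _ => epochState_succ_β s
  · exact (Fintype.expect_const _).trans_le hβ₁'

end FiniteSum

/-! ### Expected gradient norm, online setting -/

section Online

variable {E : Type*} [NormedAddCommGroup E] [NormedSpace ℝ E] [FiniteDimensional ℝ E]
  {M : Type*} [EMetricSpace M] [ChartedSpace E M] [IsManifold 𝓘(ℝ, E) ∞ M]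
  [RiemannianBundle (fun x : M => TangentSpace 𝓘(ℝ, E) x)]
  [IsContMDiffRiemannianBundle 𝓘(ℝ, E) ∞ E (fun x : M => TangentSpace 𝓘(ℝ, E) x)]
  {ι : Type*} [MeasurableSpace ι] {P : Measure ι} [IsProbabilityMeasure P] {D : Problem E M ι}

omit [IsManifold 𝓘(ℝ, E) ∞ M] [IsProbabilityMeasure P]
  [IsContMDiffRiemannianBundle 𝓘(ℝ, E) ∞ E (fun x : M => TangentSpace 𝓘(ℝ, E) x)] in
theorem Oracle.isUnbiased (hO : D.Oracle P) : D.IsUnbiased P := ⟨hO.measurable_grad, hO.unbiased⟩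

theorem integral_outputGradNorm_le (hA : D.Assumptions P) (hO : D.IsUnbiased P)
    {ε α₁ α₂ β₁ : ℝ} {m S : ℕ} {B : ℝ → ℕ}
    (hε : 0 < ε) (hα₁ : 4 ≤ α₁) (hα₂ : 4 ≤ α₂) (hm : 0 < m) (hS : S = numEpochs (D.Δ P) ε D.η m)
    (hβ₁ : 0 ≤ β₁) (hβ₁' : β₁ ≤ ε ^ 2 * S) (hB : B = onlineBatchSize α₁ α₂ D.σ ε)
    (hmeas : ∀ s < S, ∀ t < m, Measurable[MeasurableSpace.pi, borel (TangentBundle 𝓘(ℝ, E) M)]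
      (fun ζ : Draw (m ^ 2) → ι => (⟨D.iterate D.η m B β₁ ζ s t,
        D.direction D.η m B β₁ ζ s t⟩ : TangentBundle 𝓘(ℝ, E) M)))
    (hst : ∀ᵐ ζ ∂(onlineLaw P (m ^ 2)), D.StaysIn D.η m B β₁ ζ S) :
    Integrable (fun ζ => D.outputGradNorm D.η m B β₁ ζ P S) (onlineLaw P (m ^ 2)) ∧
      ∫ ζ, D.outputGradNorm D.η m B β₁ ζ P S ∂(onlineLaw P (m ^ 2)) ≤ ε := by
  have hL : 0 < D.L := hA.pos.2.2.2.1
  have hσ : 0 < D.σ := hA.pos.2.2.1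
  have hη := D.η_pos hL
  have hm' : (0 : ℝ) < m := by exact_mod_cast hm
  have hS0 : 0 < S := hS ▸ numEpochs_pos _ _ _ _
  have hS0' : (0 : ℝ) < S := by exact_mod_cast hS0
  have hb : 0 < m ^ 2 := pow_pos hm 2
  have hSm : 4 * D.Δ P ≤ S * (ε ^ 2 * m * D.η) := hS ▸ le_numEpochs_mul (by positivity)
  set ρ : Measure (Draw (m ^ 2) → ι) := onlineLaw P (m ^ 2) with hρ
  have : IsProbabilityMeasure ρ :=
    inferInstanceAs (IsProbabilityMeasure (Measure.infinitePi fun _ : Draw (m ^ 2) => P))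
  let N : (Draw (m ^ 2) → ι) → ℕ → ℕ → ℝ := fun ζ s t =>
    ‖grad (E := E) (D.obj P) (D.iterate D.η m B β₁ ζ s t)‖
  let V : (Draw (m ^ 2) → ι) → ℕ → ℕ → ℝ := fun ζ s t => ‖D.direction D.η m B β₁ ζ s t‖ ^ 2
  let e : (Draw (m ^ 2) → ι) → ℕ → ℕ → ℝ := fun ζ s t => ‖D.direction D.η m B β₁ ζ s t
    - grad (D.obj P) (D.iterate D.η m B β₁ ζ s t)‖ ^ 2
  let β : (Draw (m ^ 2) → ι) → ℕ → ℝ := fun ζ s => (D.epochState D.η m B β₁ ζ s).β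
  have hNm : ∀ s < S, ∀ t < m, Measurable fun ζ => N ζ s t := fun s hs t ht =>
    measurable_norm_grad_of_measurable_tangent hA.smooth_obj (hmeas s hs t ht)
  -- Almost surely the iterates lie in `X`, where gradients are bounded by `G`, directions by `3 G`
  -- and errors by `4 G`. Integrability thus reduces to measurability.
  have hNi : ∀ s < S, ∀ t < m, Integrable (fun ζ => N ζ s t) ρ := fun s hs t ht => by
    refine Integrable.of_bound (hNm s hs t ht).aestronglyMeasurable D.G ?_
    filter_upwards [hst] with ζ hζ
    rw [Real.norm_of_nonneg (norm_nonneg _)]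
    exact hO.norm_grad_le hA (hζ.iterate_mem_of_lt hA hs ht)
  have hN2i : ∀ s < S, ∀ t < m, Integrable (fun ζ => N ζ s t ^ 2) ρ := fun s hs t ht => by
    refine Integrable.of_bound ((hNm s hs t ht).pow_const 2).aestronglyMeasurable (D.G ^ 2) ?_
    filter_upwards [hst] with ζ hζ
    rw [Real.norm_of_nonneg (sq_nonneg _)]
    exact pow_le_pow_left₀ (norm_nonneg _)
      (hO.norm_grad_le hA (hζ.iterate_mem_of_lt hA hs ht)) 2
  have hVi : ∀ s < S, ∀ t < m, Integrable (fun ζ => V ζ s t) ρ := fun s hs t ht => by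
    refine Integrable.of_bound
      ((measurable_norm_of_measurable_tangent (hmeas s hs t ht)).pow_const 2).aestronglyMeasurable
      ((3 * D.G) ^ 2) ?_
    filter_upwards [hst] with ζ hζ
    rw [Real.norm_of_nonneg (sq_nonneg _)]
    exact pow_le_pow_left₀ (norm_nonneg _) (hζ.norm_direction_le hA hs ht) 2
  have hei : ∀ s < S, ∀ t < m, Integrable (fun ζ => e ζ s t) ρ := fun s hs t ht => by
    refine Integrable.of_bound (measurable_norm_sub_grad_sq_of_measurable_tangent hA.smooth_obj
      (hmeas s hs t ht)).aestronglyMeasurable ((4 * D.G) ^ 2) ?_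
    filter_upwards [hst] with ζ hζ
    rw [Real.norm_of_nonneg (sq_nonneg _)]
    exact pow_le_pow_left₀ (norm_nonneg _) (hζ.norm_direction_sub_le hO hA hs ht) 2
  have hβeq : ∀ ζ s, β ζ (s + 1) = (∑ t ∈ Finset.range m, V ζ s t) / m := fun ζ s =>
    epochState_succ_β s
  have hβi : ∀ s < S, Integrable (fun ζ => β ζ s) ρ := fun s hs => by
    cases s with
    | zero => exact integrable_const _
    | succ s =>
      simp only [hβeq]
      exact (integrable_finsetSum _ fun t ht =>
        hVi s (Nat.lt_of_succ_lt hs) t (Finset.mem_range.1 ht)).div_const _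
  have hsum : ∀ {f : (Draw (m ^ 2) → ι) → ℕ → ℕ → ℝ},
      (∀ s < S, ∀ t < m, Integrable (fun ζ => f ζ s t) ρ) →
      Integrable (fun ζ => ∑ s ∈ Finset.range S, ∑ t ∈ Finset.range m, f ζ s t) ρ ∧
      ∫ ζ, ∑ s ∈ Finset.range S, ∑ t ∈ Finset.range m, f ζ s t ∂ρ
        = ∑ s ∈ Finset.range S, ∑ t ∈ Finset.range m, ∫ ζ, f ζ s t ∂ρ := fun {f} hf => by
    have h1 : ∀ s ∈ Finset.range S, ∀ t ∈ Finset.range m, Integrable (fun ζ => f ζ s t) ρ :=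
      fun s hs t ht => hf s (Finset.mem_range.1 hs) t (Finset.mem_range.1 ht)
    have h2 : ∀ s ∈ Finset.range S, Integrable (fun ζ => ∑ t ∈ Finset.range m, f ζ s t) ρ :=
      fun s hs => integrable_finsetSum _ (h1 s hs)
    refine ⟨integrable_finsetSum _ h2, ?_⟩
    rw [integral_finsetSum _ h2]
    exact Finset.sum_congr rfl fun s hs => integral_finsetSum _ (h1 s hs)
  have hout : Integrable (fun ζ => D.outputGradNorm D.η m B β₁ ζ P S) ρ :=
    (hsum hNi).1.div_const _
  refine ⟨hout, ?_⟩
  have key := sum_sq_grad_le (S := S) (m := m) (η := D.η) (L := D.L) (ε := ε) (Δ := D.Δ P)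
    (κ := (D.Ll + D.θ * D.G) ^ 2 * D.μ ^ 2 * D.ν ^ 2)
    (a := fun s t => ∫ ζ, N ζ s t ^ 2 ∂ρ) (V := fun s t => ∫ ζ, V ζ s t ∂ρ)
    (e := fun s t => ∫ ζ, e ζ s t ∂ρ) (β := fun s => ∫ ζ, β ζ s ∂ρ)
    hm hη (by positivity) (fun s t => integral_nonneg fun ζ => sq_nonneg _)
    (η_condition hA) ?_ ?_ ?_ ?_ ?_ hSm
  · have hi := ((hsum hN2i).1.add (integrable_const (S * m * ε ^ 2))).div_const (2 * ε * (S * m))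
    refine (integral_mono hout hi fun ζ => outputGradNorm_le P hε hm hS0).trans ?_
    simp only [Pi.add_apply]
    rw [integral_div, integral_add (hsum hN2i).1 (integrable_const _), (hsum hN2i).2]
    simpa using average_bound hε hm' hS0' key
  · have h1 : ∀ s < S, ∀ t < m, Integrable (fun ζ => D.η / 2 * N ζ s t ^ 2
        + (D.η / 2 - D.L * D.η ^ 2 / 2) * V ζ s t - D.η / 2 * e ζ s t) ρ := fun s hs t ht =>
      (((hN2i s hs t ht).const_mul _).add ((hVi s hs t ht).const_mul _)).sub
        ((hei s hs t ht).const_mul _)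
    have h2 : ∀ s < S, ∀ t < m, ∫ ζ, (D.η / 2 * N ζ s t ^ 2
        + (D.η / 2 - D.L * D.η ^ 2 / 2) * V ζ s t - D.η / 2 * e ζ s t) ∂ρ
        = D.η / 2 * ∫ ζ, N ζ s t ^ 2 ∂ρ + (D.η / 2 - D.L * D.η ^ 2 / 2) * ∫ ζ, V ζ s t ∂ρ
          - D.η / 2 * ∫ ζ, e ζ s t ∂ρ := fun s hs t ht => by
      rw [integral_sub (f := fun ζ => D.η / 2 * N ζ s t ^ 2
          + (D.η / 2 - D.L * D.η ^ 2 / 2) * V ζ s t)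
          (((hN2i s hs t ht).const_mul _).add ((hVi s hs t ht).const_mul _))
          ((hei s hs t ht).const_mul _),
        integral_add ((hN2i s hs t ht).const_mul _) ((hVi s hs t ht).const_mul _),
        integral_const_mul, integral_const_mul, integral_const_mul]
    calc _ = ∑ s ∈ Finset.range S, ∑ t ∈ Finset.range m, ∫ ζ, (D.η / 2 * N ζ s t ^ 2
          + (D.η / 2 - D.L * D.η ^ 2 / 2) * V ζ s t - D.η / 2 * e ζ s t) ∂ρ :=
          Finset.sum_congr rfl fun s hs => Finset.sum_congr rfl fun t ht =>
            (h2 s (Finset.mem_range.1 hs) t (Finset.mem_range.1 ht)).symm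
      _ = ∫ ζ, ∑ s ∈ Finset.range S, ∑ t ∈ Finset.range m, (D.η / 2 * N ζ s t ^ 2
          + (D.η / 2 - D.L * D.η ^ 2 / 2) * V ζ s t - D.η / 2 * e ζ s t) ∂ρ :=
          (hsum (f := fun ζ s t => D.η / 2 * N ζ s t ^ 2
            + (D.η / 2 - D.L * D.η ^ 2 / 2) * V ζ s t - D.η / 2 * e ζ s t) h1).2.symm
      _ ≤ ∫ _, D.Δ P ∂ρ := by
          refine integral_mono_ae (hsum (f := fun ζ s t => D.η / 2 * N ζ s t ^ 2
            + (D.η / 2 - D.L * D.η ^ 2 / 2) * V ζ s t - D.η / 2 * e ζ s t) h1).1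
            (integrable_const _) ?_
          filter_upwards [hst] with ζ hζ using hζ.sum_descent_le hA hm hS0
      _ = _ := by simp
  · intro s hs t ht
    have hVs : ∀ j ∈ Finset.range t, Integrable (fun ζ => V ζ s j) ρ := fun j hj =>
      hVi s hs j ((Finset.mem_range.1 hj).trans ht)
    have hsumV := ((integrable_finsetSum _ hVs).const_mul (t : ℝ)).const_mul
      ((D.Ll + D.θ * D.G) ^ 2 * D.μ ^ 2 * D.ν ^ 2 * D.η ^ 2 / (m : ℝ) ^ 2)
    have hinj : Function.Injective fun k : Fin (m ^ 2) => Draw.inner s t k := fun k l h => by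
      simpa using h
    refine (integral_le_of_overwrite P hinj (hei s hs t ht) ((hei s hs 0 hm).add hsumV) ?_).trans
      (le_of_eq ?_)
    · filter_upwards [hst] with ζ hζ
      have := hζ.integral_norm_sq_direction_sub_le hO hA hb hs ht
        (fun I => overwrite (fun k : Fin (m ^ 2) => Draw.inner s t k) ζ I)
        (fun I d hd => overwrite_of_notMem (fun k => (hd k).symm) ζ I)
        (fun I k => overwrite_apply hinj ζ I k)
      rw [Nat.cast_pow] at this
      exact this
    · simp only [Pi.add_apply]
      change ∫ ζ, _ ∂ρ = _
      rw [integral_add (hei s hs 0 hm) hsumV, integral_const_mul, integral_const_mul,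
        integral_finsetSum _ hVs]
  · intro s hs
    -- The batch length is random, so the whole infinite sequence of potential batch draws of epoch
    -- `s` is redrawn. Its length `B (β ζ s)` is decided by earlier epochs and stays fixed.
    have hinj : Function.Injective fun j : ℕ => (Draw.batch s j : Draw (m ^ 2)) := fun k l h => by
      simpa using h
    refine (integral_le_of_overwrite P hinj (hei s hs 0 hm)
      (((hβi s hs).div_const 4).add (integrable_const (ε ^ 2 / 4))) ?_).trans (le_of_eq ?_)
    · filter_upwards [hst] with ζ hζ
      have hβ0 : 0 ≤ β ζ s := epochState_β_nonneg hβ₁ s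
      have hk : 0 < B (β ζ s) := hB ▸ onlineBatchSize_pos hα₁ hα₂ hσ hε hβ0
      have hle : D.σ ^ 2 / B (β ζ s) ≤ β ζ s / 4 + ε ^ 2 / 4 :=
        hB ▸ sq_div_onlineBatchSize_le hα₁ hα₂ hσ hε hβ0
      have heq : ∀ I, e (overwrite (fun j : ℕ => (Draw.batch s j : Draw (m ^ 2))) ζ I) s 0
          = ‖D.batchGrad (fun j : Fin (B (β ζ s)) => I j) (D.iterate D.η m B β₁ ζ s 0)
            - grad (D.obj P) (D.iterate D.η m B β₁ ζ s 0)‖ ^ 2 := fun I => by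
        simp only [e]
        rw [norm_direction_zero_sub_eq hA (ζ := ζ) s
          (fun l hl j => overwrite_of_notMem (fun k => by simp [hl.ne']) ζ I)
          (fun l _ j _ k => overwrite_of_notMem (fun k => by simp) ζ I)]
        simp only [overwrite_apply hinj ζ I]
        rfl
      simp only [heq]
      exact (integral_norm_sq_batchGrad_sub_le hO hA (hζ.iterate_mem_of_lt hA hs hm) hk).trans hle
    · simp only [Pi.add_apply]
      change ∫ ζ, _ ∂ρ = _
      rw [integral_add ((hβi s hs).div_const 4) (integrable_const _), integral_div]
      simp
  · intro s hs
    simp only [hβeq]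
    rw [integral_div, integral_finsetSum _ fun t ht =>
      hVi s (Nat.lt_of_succ_lt hs) t (Finset.mem_range.1 ht)]
  · have : ∀ ζ, β ζ 0 = β₁ := fun ζ => rfl
    simpa [this] using hβ₁'

end Online

end Problem

end RAbaSVRG

end

open RAbaSVRG in
theorem mainTheorem6 : ∃ ϱ C : ℝ, 0 < ϱ ∧ 0 < C ∧
    -- finite-sum setting
    (∀ (E M : Type*) [NormedAddCommGroup E] [NormedSpace ℝ E] [FiniteDimensional ℝ E]
      [EMetricSpace M] [ChartedSpace E M] [IsManifold 𝓘(ℝ, E) ∞ M]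
      [RiemannianBundle (fun x : M => TangentSpace 𝓘(ℝ, E) x)]
      [IsContMDiffRiemannianBundle 𝓘(ℝ, E) ∞ E (fun x : M => TangentSpace 𝓘(ℝ, E) x)]
      [IsRiemannianManifold 𝓘(ℝ, E) M]
      (n : ℕ) [NeZero n] (D : Problem E M (Fin n)), D.Assumptions (unif n) →
      ∀ (ε α₁ β₁ : ℝ) (m S : ℕ) (B : ℝ → ℕ), 0 < ε → 4 ≤ α₁ →
      m = ⌊(n : ℝ) ^ (1 / 3 : ℝ)⌋₊ →
      S = numEpochs (D.Δ (unif n)) ε D.η m →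
      0 < β₁ → β₁ ≤ ε ^ 2 * S →
      B = finiteSumBatchSize α₁ D.σ n →
      (∀ ζ : FiniteSumSample n S m (m ^ 2), D.StaysIn D.η m B β₁ ζ.draws S) →
      Finset.expect Finset.univ (fun ζ : FiniteSumSample n S m (m ^ 2) =>
          D.outputGradNorm D.η m B β₁ ζ.draws (unif n) S) ≤ ε ∧
      ∀ ζ : FiniteSumSample n S m (m ^ 2),
        (ε ^ 2 * m * D.η ≤ 4 * D.Δ (unif n) →
          (D.ifoCalls D.η m B β₁ ζ.draws S : ℝ) ≤
            C * (D.avgBatch D.η m B β₁ ζ.draws S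
              + D.Δ (unif n) * D.Θ ϱ * D.avgBatch D.η m B β₁ ζ.draws S
                  / ((n : ℝ) ^ (1 / 3 : ℝ) * ε ^ 2)
              + D.Δ (unif n) * D.Θ ϱ * (n : ℝ) ^ (2 / 3 : ℝ) / ε ^ 2)) ∧
        (D.ifoCalls D.η m B β₁ ζ.draws S : ℝ) ≤
          C * (n + D.avgBatch D.η m B β₁ ζ.draws S
            + D.Δ (unif n) * D.Θ ϱ * D.avgBatch D.η m B β₁ ζ.draws S
                / ((n : ℝ) ^ (1 / 3 : ℝ) * ε ^ 2)
            + D.Δ (unif n) * D.Θ ϱ * (n : ℝ) ^ (2 / 3 : ℝ) / ε ^ 2)) ∧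
    -- online setting
    (∀ (E M ι : Type*) [NormedAddCommGroup E] [NormedSpace ℝ E] [FiniteDimensional ℝ E]
      [EMetricSpace M] [ChartedSpace E M] [IsManifold 𝓘(ℝ, E) ∞ M]
      [RiemannianBundle (fun x : M => TangentSpace 𝓘(ℝ, E) x)]
      [IsContMDiffRiemannianBundle 𝓘(ℝ, E) ∞ E (fun x : M => TangentSpace 𝓘(ℝ, E) x)]
      [IsRiemannianManifold 𝓘(ℝ, E) M]
      [MeasurableSpace ι] (P : MeasureTheory.Measure ι) [MeasureTheory.IsProbabilityMeasure P]
      (D : Problem E M ι), D.Assumptions P → D.Oracle P →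
      ∀ (ε α₁ α₂ β₁ : ℝ) (m S : ℕ) (B : ℝ → ℕ), 0 < ε → 4 ≤ α₁ → 4 ≤ α₂ →
      m = ⌈(D.σ / ε) ^ (2 / 3 : ℝ)⌉₊ →
      S = numEpochs (D.Δ P) ε D.η m →
      0 < β₁ → β₁ ≤ ε ^ 2 * S →
      B = onlineBatchSize α₁ α₂ D.σ ε →
      (∀ s < S, ∀ t < m, Measurable[MeasurableSpace.pi, borel (TangentBundle 𝓘(ℝ, E) M)]
        (fun ζ : Draw (m ^ 2) → ι => (⟨D.iterate D.η m B β₁ ζ s t,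
          D.direction D.η m B β₁ ζ s t⟩ : TangentBundle 𝓘(ℝ, E) M))) →
      (∀ᵐ ζ ∂(onlineLaw P (m ^ 2)), D.StaysIn D.η m B β₁ ζ S) →
      MeasureTheory.Integrable (fun ζ => D.outputGradNorm D.η m B β₁ ζ P S)
          (onlineLaw P (m ^ 2)) ∧
      ∫ ζ, D.outputGradNorm D.η m B β₁ ζ P S ∂(onlineLaw P (m ^ 2)) ≤ ε ∧
      ∀ ζ : Draw (m ^ 2) → ι,
        (ε ^ 2 * m * D.η ≤ 4 * D.Δ P →
          (D.ifoCalls D.η m B β₁ ζ S : ℝ) ≤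
            C * (D.Δ P * D.Θ ϱ * D.avgBatch D.η m B β₁ ζ S
                / (D.σ ^ (2 / 3 : ℝ) * ε ^ (4 / 3 : ℝ))
              + D.Δ P * D.Θ ϱ * D.σ ^ (4 / 3 : ℝ) / ε ^ (10 / 3 : ℝ))) ∧
        (D.ifoCalls D.η m B β₁ ζ S : ℝ) ≤
          C * (D.σ ^ 2 / ε ^ 2 + D.avgBatch D.η m B β₁ ζ S
            + D.Δ P * D.Θ ϱ * D.avgBatch D.η m B β₁ ζ S
                / (D.σ ^ (2 / 3 : ℝ) * ε ^ (4 / 3 : ℝ))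
            + D.Δ P * D.Θ ϱ * D.σ ^ (4 / 3 : ℝ) / ε ^ (10 / 3 : ℝ))) := by
  -- The value `3` is the coefficient under the root in the step size. The value `48` dominates all
  -- constants of the two counts, the largest being `128/3`, the coefficient of `A p²` in the online
  -- case.
  refine ⟨3, 48, by norm_num, by norm_num, ?_, ?_⟩
  · intro E M _ _ _ _ _ _ _ _ _ n _ D hA ε α₁ β₁ m S B hε hα₁ hm hS hβ₁ hβ₁' hB hst
    subst hB
    have hn : (1 : ℝ) ≤ n := by exact_mod_cast NeZero.one_le
    have hm0 : 0 < m := by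
      rw [hm]
      exact Nat.floor_pos.2 (Real.one_le_rpow hn (by norm_num))
    refine ⟨Problem.expect_outputGradNorm_le hA hε hα₁ hm0 hS hβ₁.le hβ₁' hst, fun ζ => ?_⟩
    exact Problem.ifoCalls_le_finite hA.pos.2.2.2.1
      ((hst ζ).Δ_nonneg hA hm0 (hS ▸ numEpochs_pos _ _ _ _)) hε hβ₁.le
      (fun β hβ => finiteSumBatchSize_pos hα₁ hA.pos.2.2.1 hβ) hm hS
  · intro E M ι _ _ _ _ _ _ _ _ _ _ P _ D hA hO ε α₁ α₂ β₁ m S B hε hα₁ hα₂ hm hS hβ₁ hβ₁' hB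
      hmeas hst
    have hσ := hA.pos.2.2.1
    have hm0 : 0 < m := by
      rw [hm]
      exact Nat.ceil_pos.2 (by positivity)
    have : IsProbabilityMeasure (onlineLaw P (m ^ 2)) :=
      inferInstanceAs (IsProbabilityMeasure (Measure.infinitePi fun _ : Draw (m ^ 2) => P))
    -- One trajectory staying in `X` places the initial point in `X`, whence `Δ ≥ 0`. Nothing more
    -- about trajectories enters the count, so it holds for every `ζ`, not just almost surely.
    obtain ⟨ζ₀, hζ₀⟩ := hst.exists
    obtain ⟨h1, h2⟩ := Problem.integral_outputGradNorm_le hA hO.isUnbiased hε hα₁ hα₂ hm0 hS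
      hβ₁.le hβ₁' hB hmeas hst
    refine ⟨h1, h2, fun ζ => ?_⟩
    exact Problem.ifoCalls_le_online hσ hA.pos.2.2.2.1
      (hζ₀.Δ_nonneg hA hm0 (hS ▸ numEpochs_pos _ _ _ _)) hε hβ₁.le
      (fun β hβ => hB ▸ onlineBatchSize_pos hα₁ hα₂ hσ hε hβ) hm hS
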